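/- Let $\mathcal D$ be a multifusion category over $\mathbb C$ (a rigid $\mathbb C$-linear abelian monoidal category with finite-dimensional Hom spaces, in which every object is a finite direct sum of simple ones and there are finitely many simple objects up to isomorphism), for instance a unitary one. Letters $a,b,c,\dots$ denote representatives of the simple objects. Consider * the bulk tube algebra $\mathbf{Tube}({}_{\mathcal D}\mathcal D_{\mathcal D})=\bigoplus_{a,b,c,e,f,h}\operatorname{Hom}(c,(a\otimes e)\otimes b)\otimes\operatorname{Hom}((a\otimes f)\otimes b,h)$, spanned by the diagrams with left arc $a$, right arc $b$, and vertices $\mu:c\to d\otimes b$, $\nu:d\to a\otimes e$ (lower half), $\zeta:a\otimes f\to g$, $\gamma:g\otimes b\to h$ (upper half); * the left boundary tube algebra $\tilde{\mathbf L}({}_{\mathcal D}\mathcal D)=\bigoplus_{a,d,e,f,g}\operatorname{Hom}(d,a\otimes e)\otimes\operatorname{Hom}(a\otimes f,g)$ and the right one $\tilde{\mathbf R}(\mathcal D_{\mathcal D})=\bigoplus_{b,c,e,f,h}\operatorname{Hom}(c,e\otimes b)\otimes\operatorname{Hom}(f\otimes b,h)$. In each of them, the product $XY$ puts the diagram $Y$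 inside $X$ (it is $0$ unless the two inner edge labels of $X$ equal the two outer edge labels of $Y$), and the parallel arcs are then fused into simple ones by inserting $\mathrm{id}_{a\otimes a'}=\sum_{k,\alpha}v_\alpha v^\alpha$, with dual bases $v_\alpha\in\operatorname{Hom}(k,a\otimes a')$, $v^\alpha\in\operatorname{Hom}(a\otimes a',k)$. The unit is the sum of the diagrams with trivial arcs over all pairs of edge labels. The coproduct inserts an edge $i$ between the lower and the upper inner edge, sums over $i$ and applies the same resolution of the identity to the arcs together with $i$. The counit joins the two inner edges and the two outer edges (it is $0$ if their labels differ) and takes the scalar by which the resulting endomorphism of the outer edge acts. The crossed product $\tilde{\mathbf R}\Join\tilde{\mathbf L}$ is the quotient of $\tilde{\mathbf R}\otimes\tilde{\mathbf L}$ by the span of all $r\otimes l$ for which the inner edge labels of the diagram $r$ are not equal to the outer edge labels of the diagram $l$. Write $r\Join l$ for the class of $r\otimes l$. Its product is $(r\Join l)(r'\Join l')=\sum rr''\Join l''l'$, where $\sum r''\otimes l''\in\tilde{\mathbf R}\otimes\tilde{\mathbf L}$ is obtained by rebracketing (F-moves) the diagram in which $r'$ is placed inside $l$. Its unit is $1\Join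 1$ and its coproduct is $\Delta(r\Join l)=\sum(r_{(1)}\Join l_{(1)})\otimes(r_{(2)}\Join l_{(2)})$. Then: 1. $\mathbf{Tube}({}_{\mathcal D}\mathcal D_{\mathcal D})$, $\tilde{\mathbf L}({}_{\mathcal D}\mathcal D)$, $\tilde{\mathbf R}(\mathcal D_{\mathcal D})$ and $\tilde{\mathbf R}(\mathcal D_{\mathcal D})\Join\tilde{\mathbf L}({}_{\mathcal D}\mathcal D)$ are unital associative algebras. 2. Adding a trivial right arc defines a linear map $\iota_L:\tilde{\mathbf L}({}_{\mathcal D}\mathcal D)\to\mathbf{Tube}({}_{\mathcal D}\mathcal D_{\mathcal D})$ that preserves product, unit, coproduct and counit. Its image is the span $\mathbf L({}_{\mathcal D}\mathcal D)$ of the bulk diagrams whose right arc is a simple summand of $\mathbf 1$. Its kernel is the span of the diagrams whose outer edges $d,g$ lie in different columns of the canonical grading $\mathcal D=\bigoplus_{i,j}\mathcal D_{i,j}$ (that is, $d\in\mathcal D_{i,j}$, $g\in\mathcal D_{i',j'}$ with $j\ne j'$). In particular $\iota_L$ is an embedding if $\mathbf 1$ is simple. Likewise, adding a trivial left arc defines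 $\iota_R:\tilde{\mathbf R}(\mathcal D_{\mathcal D})\to\mathbf{Tube}({}_{\mathcal D}\mathcal D_{\mathcal D})$, which preserves product, unit, coproduct and counit. Its image is the span $\mathbf R(\mathcal D_{\mathcal D})$ of the bulk diagrams whose left arc is a simple summand of $\mathbf 1$, its kernel is spanned by the diagrams whose outer edges lie in different rows, and it is an embedding if $\mathbf 1$ is simple. 3. There is a linear isomorphism $\Phi:\tilde{\mathbf R}(\mathcal D_{\mathcal D})\Join\tilde{\mathbf L}({}_{\mathcal D}\mathcal D)\to\mathbf{Tube}({}_{\mathcal D}\mathcal D_{\mathcal D})$ given by gluing: it sends the class of (right diagram with vertices $\mu,\gamma$) $\otimes$ (left diagram with vertices $\nu,\zeta$) to the bulk diagram with vertices $\mu,\nu,\zeta,\gamma$ if the inner edge labels of the first equal the outer edge labels of the second, and to $0$ otherwise. Equivalently, $\Phi(r\Join l)=\iota_R(r)\,\iota_L(l)$ for all $r,l$. The map $\Phi$ is an isomorphism of unital algebras and is compatible with comultiplication, $\Delta\circ\Phi=(\Phi\otimes\Phi)\circ\Delta$. -/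

import Mathlib

open CategoryTheory MonoidalCategory Limits
open scoped TensorProduct

universe v u

noncomputable section

namespace TubeAlgebra

attribute [local instance] Abelian.hasFiniteBiproducts

section Category

/-- Isomorphism classes of simple objects. -/
def Irr (C : Type u) [Category.{v} C] [Abelian C] : Type u :=
  {x : Quotient (isIsomorphicSetoid C) // Simple x.out}

instance (C : Type u) [Category.{v} C] [Abelian C] : DecidableEq (Irr C) := Classical.decEq _

/-- The chosen simple object in the isomorphism class `x`. -/
def Irr.obj {C : Type u} [Category.{v} C] [Abelian C] (x : Irr C) : C := x.1.out

/-- A multifusion category over `ℂ`: a rigid, `ℂ`-linear, abelian monoidal category with bilinear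
tensor product and finite-dimensional morphism spaces, in which every object is a finite direct sum
of simple objects, and which has finitely many simple objects up to isomorphism.
The tensor unit need not be simple. -/
class MultifusionCategory (C : Type u) [Category.{v} C] [Abelian C] [Linear ℂ C]
    [MonoidalCategory C] [MonoidalPreadditive C] [MonoidalLinear ℂ C] [RigidCategory C] :
    Prop where
  finiteDimensional_hom : ∀ X Y : C, FiniteDimensional ℂ (X ⟶ Y)
  finite_irr : Finite (Irr C)
  semisimple : ∀ X : C, ∃ (n : ℕ) (Y : Fin n → C), (∀ i, Simple (Y i)) ∧ Nonempty (X ≅ ⨁ Y)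

/-- A decomposition of `X` as a direct sum of the chosen simple objects. With `X = a ⊗ b` the
inclusions and projections are dual bases of the splitting spaces `Hom(c, a ⊗ b)` and of the fusion
spaces `Hom(a ⊗ b, c)`, and `total` is the parallel move `𝟙 = ∑ |a b → c⟩⟨c → a b|`. -/
structure SimpleDecomp {C : Type u} [Category.{v} C] [Abelian C] (X : C) where
  n : ℕ
  label : Fin n → Irr C
  incl : ∀ i, (label i).obj ⟶ X
  proj : ∀ i, X ⟶ (label i).obj
  incl_proj_self : ∀ i, incl i ≫ proj i = 𝟙 _
  incl_proj_ne : ∀ i j, i ≠ j → incl i ≫ proj j = 0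
  total : ∑ i, proj i ≫ incl i = 𝟙 X

/-- The identity if `x = y`, and zero otherwise (the Kronecker delta of edge labels). -/
def edge {C : Type u} [Category.{v} C] [Abelian C] (x y : Irr C) : x.obj ⟶ y.obj :=
  if h : x = y then eqToHom (by rw [h]) else 0

theorem edge_of_ne {C : Type u} [Category.{v} C] [Abelian C] {x y : Irr C} (h : x ≠ y) :
    edge x y = 0 := dif_neg h

end Category

section Algebra

variable {C : Type u} [Category.{v} C] [Abelian C] [Linear ℂ C]
  [MonoidalCategory C] [MonoidalPreadditive C] [MonoidalLinear ℂ C] [RigidCategory C]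

theorem exists_irr_iso (Y : C) (hY : Simple Y) : ∃ x : Irr C, Nonempty (Y ≅ x.obj) := by
  have h : Nonempty ((Quotient.mk (isIsomorphicSetoid C) Y).out ≅ Y) :=
    Quotient.exact (Quotient.out_eq (Quotient.mk (isIsomorphicSetoid C) Y))
  obtain ⟨e⟩ := h
  exact ⟨⟨Quotient.mk (isIsomorphicSetoid C) Y, Simple.of_iso e⟩, ⟨e.symm⟩⟩

variable [MultifusionCategory C]

instance : Fintype (Irr C) :=
  haveI : Finite (Irr C) := MultifusionCategory.finite_irr
  Fintype.ofFinite _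

theorem nonempty_simpleDecomp (X : C) : Nonempty (SimpleDecomp X) := by
  obtain ⟨n, Y, hY, ⟨e⟩⟩ := MultifusionCategory.semisimple X
  choose x hx using fun i => exists_irr_iso (Y i) (hY i)
  let f : ∀ i, Y i ≅ (x i).obj := fun i => (hx i).some
  refine ⟨⟨n, x, fun i => (f i).inv ≫ biproduct.ι Y i ≫ e.inv,
    fun i => e.hom ≫ biproduct.π Y i ≫ (f i).hom, ?_, ?_, ?_⟩⟩
  · intro i
    simp
  · intro i j hij
    simp [biproduct.ι_π_ne_assoc Y hij]
  · have : ∀ i, (e.hom ≫ biproduct.π Y i ≫ (f i).hom) ≫ (f i).inv ≫ biproduct.ι Y i ≫ e.inv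
        = e.hom ≫ (biproduct.π Y i ≫ biproduct.ι Y i) ≫ e.inv := by
      intro i
      simp
    simp only [this]
    rw [← Preadditive.comp_sum, ← Preadditive.sum_comp, biproduct.total]
    simp

/-- A chosen decomposition of `X`; all constructions below are independent of the choice. -/
def decomp (X : C) : SimpleDecomp X := (nonempty_simpleDecomp X).some

/-- The scalar `r` with `f = r • 𝟙`, for an endomorphism `f` of a simple object (written as the
trace of composition with `f` on the one-dimensional space of endomorphisms). -/
def scalar (x : Irr C) : (x.obj ⟶ x.obj) →ₗ[ℂ] ℂ :=
  LinearMap.trace ℂ (x.obj ⟶ x.obj) ∘ₗ Linear.comp x.obj x.obj x.obj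

variable (C)

/-! ### The spaces -/

/-- Edge labels of a bulk tube diagram: left arc `a`, right arc `b`, lower outer edge `c`,
lower inner edge `e`, upper inner edge `f`, upper outer edge `h`. -/
structure TubeLabel where
  (a b c e f h : Irr C)

/-- Edge labels of a left boundary tube diagram: arc `a`, lower outer edge `d`,
lower inner edge `e`, upper inner edge `f`, upper outer edge `g`. -/
structure LLabel where
  (a d e f g : Irr C)

/-- Edge labels of a right boundary tube diagram: arc `b`, lower outer edge `c`,
lower inner edge `e`, upper inner edge `f`, upper outer edge `h`. -/
structure RLabel where
  (b c e f h : Irr C)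

instance : DecidableEq (TubeLabel C) := Classical.decEq _
instance : DecidableEq (LLabel C) := Classical.decEq _
instance : DecidableEq (RLabel C) := Classical.decEq _

variable {C}

/-- Lower halves of tube diagrams. -/
abbrev TubeLabel.Low (t : TubeLabel C) : Type v := t.c.obj ⟶ (t.a.obj ⊗ t.e.obj) ⊗ t.b.obj
/-- Upper halves of tube diagrams. -/
abbrev TubeLabel.Up (t : TubeLabel C) : Type v := (t.a.obj ⊗ t.f.obj) ⊗ t.b.obj ⟶ t.h.obj
/-- Lower vertex of a left boundary diagram. -/
abbrev LLabel.Low (t : LLabel C) : Type v := t.d.obj ⟶ t.a.obj ⊗ t.e.obj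
/-- Upper vertex of a left boundary diagram. -/
abbrev LLabel.Up (t : LLabel C) : Type v := t.a.obj ⊗ t.f.obj ⟶ t.g.obj
/-- Lower vertex of a right boundary diagram. -/
abbrev RLabel.Low (t : RLabel C) : Type v := t.c.obj ⟶ t.e.obj ⊗ t.b.obj
/-- Upper vertex of a right boundary diagram. -/
abbrev RLabel.Up (t : RLabel C) : Type v := t.f.obj ⊗ t.b.obj ⟶ t.h.obj

variable (C)

/-- The bulk tube algebra. A pair of morphisms `p ⊗ q` stands for the diagram whose lower half is
`p` and whose upper half is `q`; the two halves of a diagram are the morphisms they evaluate to, so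
that a trivalent vertex carries its normalization factor and no dimension factors appear in the
structure maps. (If the vertices are `(d_a d_b / d_c) ^ (1/4)` times orthonormal basis vectors, then
the structure constants acquire the usual factors `√(d_a d_a' / d_k)`.) -/
abbrev Tube : Type _ := DirectSum (TubeLabel C) fun t => t.Low ⊗[ℂ] t.Up

/-- The left boundary tube algebra of the regular left module. -/
abbrev LTube : Type _ := DirectSum (LLabel C) fun t => t.Low ⊗[ℂ] t.Up

/-- The right boundary tube algebra of the regular right module. -/
abbrev RTube : Type _ := DirectSum (RLabel C) fun t => t.Low ⊗[ℂ] t.Up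

variable {C}

/-- The element of the bulk tube algebra with the given labels. -/
abbrev tubeOf (t : TubeLabel C) : t.Low ⊗[ℂ] t.Up →ₗ[ℂ] Tube C :=
  DirectSum.lof ℂ (TubeLabel C) (fun t => t.Low ⊗[ℂ] t.Up) t
/-- The element of the left boundary tube algebra with the given labels. -/
abbrev lOf (t : LLabel C) : t.Low ⊗[ℂ] t.Up →ₗ[ℂ] LTube C :=
  DirectSum.lof ℂ (LLabel C) (fun t => t.Low ⊗[ℂ] t.Up) t
/-- The element of the right boundary tube algebra with the given labels. -/
abbrev rOf (t : RLabel C) : t.Low ⊗[ℂ] t.Up →ₗ[ℂ] RTube C :=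
  DirectSum.lof ℂ (RLabel C) (fun t => t.Low ⊗[ℂ] t.Up) t

/-- The bulk diagram with four trivalent vertices `μ : c ⟶ d ⊗ b`, `ν : d ⟶ a ⊗ e`,
`ζ : a ⊗ f ⟶ g`, `γ : g ⊗ b ⟶ h`. -/
def diagram {a b c d e f g h : Irr C} (μ : c.obj ⟶ d.obj ⊗ b.obj) (ν : d.obj ⟶ a.obj ⊗ e.obj)
    (ζ : a.obj ⊗ f.obj ⟶ g.obj) (γ : g.obj ⊗ b.obj ⟶ h.obj) : Tube C :=
  tubeOf ⟨a, b, c, e, f, h⟩ ((μ ≫ ν ▷ b.obj) ⊗ₜ[ℂ] (ζ ▷ b.obj ≫ γ))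

/-- The left boundary diagram with vertices `ν` and `ζ`. -/
def lDiagram {a d e f g : Irr C} (ν : d.obj ⟶ a.obj ⊗ e.obj) (ζ : a.obj ⊗ f.obj ⟶ g.obj) :
    LTube C :=
  lOf ⟨a, d, e, f, g⟩ (ν ⊗ₜ[ℂ] ζ)

/-- The right boundary diagram with vertices `μ` and `γ`. -/
def rDiagram {b c d g h : Irr C} (μ : c.obj ⟶ d.obj ⊗ b.obj) (γ : g.obj ⊗ b.obj ⟶ h.obj) :
    RTube C :=
  rOf ⟨b, c, d, g, h⟩ (μ ⊗ₜ[ℂ] γ)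

/-! ### Diagrams whose arcs carry arbitrary objects -/

/-- A tube diagram whose arcs carry arbitrary objects `A` and `B`, evaluated by the parallel move:
both arcs are decomposed into simple ones. -/
def resolve (A B : C) (c e f h : Irr C) :
    (c.obj ⟶ (A ⊗ e.obj) ⊗ B) ⊗[ℂ] ((A ⊗ f.obj) ⊗ B ⟶ h.obj) →ₗ[ℂ] Tube C :=
  ∑ i : Fin (decomp A).n, ∑ j : Fin (decomp B).n,
    tubeOf ⟨(decomp A).label i, (decomp B).label j, c, e, f, h⟩ ∘ₗ
      TensorProduct.map
        (Linear.rightComp ℂ c.obj (((decomp A).proj i ▷ e.obj) ⊗ₘ (decomp B).proj j))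
        (Linear.leftComp ℂ h.obj (((decomp A).incl i ▷ f.obj) ⊗ₘ (decomp B).incl j))

/-- A left boundary diagram whose arc carries an arbitrary object. -/
def lResolve (A : C) (d e f g : Irr C) :
    (d.obj ⟶ A ⊗ e.obj) ⊗[ℂ] (A ⊗ f.obj ⟶ g.obj) →ₗ[ℂ] LTube C :=
  ∑ i : Fin (decomp A).n,
    lOf ⟨(decomp A).label i, d, e, f, g⟩ ∘ₗ
      TensorProduct.map
        (Linear.rightComp ℂ d.obj ((decomp A).proj i ▷ e.obj))
        (Linear.leftComp ℂ g.obj ((decomp A).incl i ▷ f.obj))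

/-- A right boundary diagram whose arc carries an arbitrary object. -/
def rResolve (B : C) (c e f h : Irr C) :
    (c.obj ⟶ e.obj ⊗ B) ⊗[ℂ] (f.obj ⊗ B ⟶ h.obj) →ₗ[ℂ] RTube C :=
  ∑ i : Fin (decomp B).n,
    rOf ⟨(decomp B).label i, c, e, f, h⟩ ∘ₗ
      TensorProduct.map
        (Linear.rightComp ℂ c.obj (e.obj ◁ (decomp B).proj i))
        (Linear.leftComp ℂ h.obj (f.obj ◁ (decomp B).incl i))

/-! ### The bulk tube algebra: structure maps -/

/-- Rebracketing of two nested pairs of arcs around an edge `x`. -/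
def nest (A A' x B' B : C) :
    (A ⊗ ((A' ⊗ x) ⊗ B')) ⊗ B ≅ ((A ⊗ A') ⊗ x) ⊗ (B' ⊗ B) :=
  whiskerRightIso ((α_ A (A' ⊗ x) B').symm ≪≫ whiskerRightIso (α_ A A' x).symm B') B ≪≫
    α_ ((A ⊗ A') ⊗ x) B' B

/-- Lower half of the stacking of two diagrams, the second one inside the first one. -/
def lowStack (t t' : TubeLabel C) : t.Low →ₗ[ℂ] t'.Low →ₗ[ℂ]
    (t.c.obj ⟶ ((t.a.obj ⊗ t'.a.obj) ⊗ t'.e.obj) ⊗ (t'.b.obj ⊗ t.b.obj)) :=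
  LinearMap.mk₂ ℂ
    (fun p p' => p ≫ (t.a.obj ◁ (edge t.e t'.c ≫ p')) ▷ t.b.obj ≫ (nest _ _ _ _ _).hom)
    (by intros; simp) (by intros; simp) (by intros; simp) (by intros; simp)

/-- Upper half of the stacking of two diagrams, the second one inside the first one. -/
def upStack (t t' : TubeLabel C) : t.Up →ₗ[ℂ] t'.Up →ₗ[ℂ]
    (((t.a.obj ⊗ t'.a.obj) ⊗ t'.f.obj) ⊗ (t'.b.obj ⊗ t.b.obj) ⟶ t.h.obj) :=
  LinearMap.mk₂ ℂ
    (fun q q' => (nest _ _ _ _ _).inv ≫ (t.a.obj ◁ (q' ≫ edge t'.h t.f)) ▷ t.b.obj ≫ q)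
    (by intros; simp) (by intros; simp) (by intros; simp) (by intros; simp)

/-- Multiplication: the second diagram is put inside the first one (zero unless the labels of the
glued edges agree), and the two pairs of parallel arcs are fused. -/
def tubeMul : Tube C →ₗ[ℂ] Tube C →ₗ[ℂ] Tube C :=
  DirectSum.toModule ℂ (TubeLabel C) _ fun t =>
    (DirectSum.toModule ℂ (TubeLabel C) _ fun t' =>
      ((TensorProduct.map₂ (lowStack t t') (upStack t t')).compr₂
        (resolve (t.a.obj ⊗ t'.a.obj) (t'.b.obj ⊗ t.b.obj) t.c t'.e t'.f t.h)).flip).flip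

/-- The unit: the sum over `c` and `h` of the diagrams with both arcs trivial. -/
def tubeOne : Tube C :=
  ∑ c : Irr C, ∑ h : Irr C, resolve (𝟙_ C) (𝟙_ C) c c h h
    (((λ_ c.obj).inv ≫ (ρ_ (𝟙_ C ⊗ c.obj)).inv) ⊗ₜ[ℂ]
      ((ρ_ (𝟙_ C ⊗ h.obj)).hom ≫ (λ_ h.obj).hom))

/-- Comultiplication: an edge `i` is inserted between the lower and the upper inner edge, and the
parallel move is applied to `a`, `i` and `b`. -/
def tubeComul : Tube C →ₗ[ℂ] Tube C ⊗[ℂ] Tube C :=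
  DirectSum.toModule ℂ (TubeLabel C) _ fun t =>
    ∑ i : Irr C, ∑ m : Fin (decomp ((t.a.obj ⊗ i.obj) ⊗ t.b.obj)).n,
      let D := decomp ((t.a.obj ⊗ i.obj) ⊗ t.b.obj)
      let s : TubeLabel C := ⟨t.a, t.b, D.label m, i, t.f, t.h⟩
      let s' : TubeLabel C := ⟨t.a, t.b, t.c, t.e, i, D.label m⟩
      TensorProduct.map (tubeOf s ∘ₗ TensorProduct.mk ℂ s.Low s.Up (D.incl m))
          (tubeOf s' ∘ₗ (TensorProduct.mk ℂ s'.Low s'.Up).flip (D.proj m)) ∘ₗ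
        (TensorProduct.comm ℂ t.Low t.Up).toLinearMap

/-- Counit: the inner edges and the outer edges are closed up, and the resulting diagram is
evaluated, normalized by the dimension of the outer edge. -/
def tubeCounit : Tube C →ₗ[ℂ] ℂ :=
  DirectSum.toModule ℂ (TubeLabel C) _ fun t =>
    scalar t.c ∘ₗ TensorProduct.lift
      ((Linear.comp t.c.obj ((t.a.obj ⊗ t.e.obj) ⊗ t.b.obj) t.c.obj).compl₂
        (Linear.leftComp ℂ t.c.obj ((t.a.obj ◁ edge t.e t.f) ▷ t.b.obj) ∘ₗ
          Linear.rightComp ℂ ((t.a.obj ⊗ t.f.obj) ⊗ t.b.obj) (edge t.h t.c)))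

/-! ### The left boundary tube algebra: structure maps -/

/-- Lower half of the stacking of two left boundary diagrams. -/
def lLowStack (t t' : LLabel C) : t.Low →ₗ[ℂ] t'.Low →ₗ[ℂ]
    (t.d.obj ⟶ (t.a.obj ⊗ t'.a.obj) ⊗ t'.e.obj) :=
  LinearMap.mk₂ ℂ
    (fun p p' => p ≫ t.a.obj ◁ (edge t.e t'.d ≫ p') ≫ (α_ _ _ _).inv)
    (by intros; simp) (by intros; simp) (by intros; simp) (by intros; simp)

/-- Upper half of the stacking of two left boundary diagrams. -/
def lUpStack (t t' : LLabel C) : t.Up →ₗ[ℂ] t'.Up →ₗ[ℂ]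
    ((t.a.obj ⊗ t'.a.obj) ⊗ t'.f.obj ⟶ t.g.obj) :=
  LinearMap.mk₂ ℂ
    (fun q q' => (α_ _ _ _).hom ≫ t.a.obj ◁ (q' ≫ edge t'.g t.f) ≫ q)
    (by intros; simp) (by intros; simp) (by intros; simp) (by intros; simp)

/-- Multiplication of left boundary diagrams. -/
def lMul : LTube C →ₗ[ℂ] LTube C →ₗ[ℂ] LTube C :=
  DirectSum.toModule ℂ (LLabel C) _ fun t =>
    (DirectSum.toModule ℂ (LLabel C) _ fun t' =>
      ((TensorProduct.map₂ (lLowStack t t') (lUpStack t t')).compr₂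
        (lResolve (t.a.obj ⊗ t'.a.obj) t.d t'.e t'.f t.g)).flip).flip

/-- The unit of the left boundary tube algebra. -/
def lOne : LTube C :=
  ∑ d : Irr C, ∑ g : Irr C, lResolve (𝟙_ C) d d g g ((λ_ d.obj).inv ⊗ₜ[ℂ] (λ_ g.obj).hom)

/-- Comultiplication of left boundary diagrams. -/
def lComul : LTube C →ₗ[ℂ] LTube C ⊗[ℂ] LTube C :=
  DirectSum.toModule ℂ (LLabel C) _ fun t =>
    ∑ i : Irr C, ∑ m : Fin (decomp (t.a.obj ⊗ i.obj)).n,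
      let D := decomp (t.a.obj ⊗ i.obj)
      let s : LLabel C := ⟨t.a, D.label m, i, t.f, t.g⟩
      let s' : LLabel C := ⟨t.a, t.d, t.e, i, D.label m⟩
      TensorProduct.map (lOf s ∘ₗ TensorProduct.mk ℂ s.Low s.Up (D.incl m))
          (lOf s' ∘ₗ (TensorProduct.mk ℂ s'.Low s'.Up).flip (D.proj m)) ∘ₗ
        (TensorProduct.comm ℂ t.Low t.Up).toLinearMap

/-- Counit of the left boundary tube algebra. -/
def lCounit : LTube C →ₗ[ℂ] ℂ :=
  DirectSum.toModule ℂ (LLabel C) _ fun t =>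
    scalar t.d ∘ₗ TensorProduct.lift
      ((Linear.comp t.d.obj (t.a.obj ⊗ t.e.obj) t.d.obj).compl₂
        (Linear.leftComp ℂ t.d.obj (t.a.obj ◁ edge t.e t.f) ∘ₗ
          Linear.rightComp ℂ (t.a.obj ⊗ t.f.obj) (edge t.g t.d)))

/-! ### The right boundary tube algebra: structure maps -/

/-- Lower half of the stacking of two right boundary diagrams. -/
def rLowStack (t t' : RLabel C) : t.Low →ₗ[ℂ] t'.Low →ₗ[ℂ]
    (t.c.obj ⟶ t'.e.obj ⊗ (t'.b.obj ⊗ t.b.obj)) :=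
  LinearMap.mk₂ ℂ
    (fun p p' => p ≫ (edge t.e t'.c ≫ p') ▷ t.b.obj ≫ (α_ _ _ _).hom)
    (by intros; simp) (by intros; simp) (by intros; simp) (by intros; simp)

/-- Upper half of the stacking of two right boundary diagrams. -/
def rUpStack (t t' : RLabel C) : t.Up →ₗ[ℂ] t'.Up →ₗ[ℂ]
    (t'.f.obj ⊗ (t'.b.obj ⊗ t.b.obj) ⟶ t.h.obj) :=
  LinearMap.mk₂ ℂ
    (fun q q' => (α_ _ _ _).inv ≫ (q' ≫ edge t'.h t.f) ▷ t.b.obj ≫ q)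
    (by intros; simp) (by intros; simp) (by intros; simp) (by intros; simp)

/-- Multiplication of right boundary diagrams. -/
def rMul : RTube C →ₗ[ℂ] RTube C →ₗ[ℂ] RTube C :=
  DirectSum.toModule ℂ (RLabel C) _ fun t =>
    (DirectSum.toModule ℂ (RLabel C) _ fun t' =>
      ((TensorProduct.map₂ (rLowStack t t') (rUpStack t t')).compr₂
        (rResolve (t'.b.obj ⊗ t.b.obj) t.c t'.e t'.f t.h)).flip).flip

/-- The unit of the right boundary tube algebra. -/
def rOne : RTube C :=
  ∑ c : Irr C, ∑ h : Irr C, rResolve (𝟙_ C) c c h h ((ρ_ c.obj).inv ⊗ₜ[ℂ] (ρ_ h.obj).hom)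

/-- Comultiplication of right boundary diagrams. -/
def rComul : RTube C →ₗ[ℂ] RTube C ⊗[ℂ] RTube C :=
  DirectSum.toModule ℂ (RLabel C) _ fun t =>
    ∑ i : Irr C, ∑ m : Fin (decomp (i.obj ⊗ t.b.obj)).n,
      let D := decomp (i.obj ⊗ t.b.obj)
      let s : RLabel C := ⟨t.b, D.label m, i, t.f, t.h⟩
      let s' : RLabel C := ⟨t.b, t.c, t.e, i, D.label m⟩
      TensorProduct.map (rOf s ∘ₗ TensorProduct.mk ℂ s.Low s.Up (D.incl m))
          (rOf s' ∘ₗ (TensorProduct.mk ℂ s'.Low s'.Up).flip (D.proj m)) ∘ₗ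
        (TensorProduct.comm ℂ t.Low t.Up).toLinearMap

/-- Counit of the right boundary tube algebra. -/
def rCounit : RTube C →ₗ[ℂ] ℂ :=
  DirectSum.toModule ℂ (RLabel C) _ fun t =>
    scalar t.c ∘ₗ TensorProduct.lift
      ((Linear.comp t.c.obj (t.e.obj ⊗ t.b.obj) t.c.obj).compl₂
        (Linear.leftComp ℂ t.c.obj (edge t.e t.f ▷ t.b.obj) ∘ₗ
          Linear.rightComp ℂ (t.f.obj ⊗ t.b.obj) (edge t.h t.c)))

/-! ### The boundary tube algebras inside the bulk tube algebra -/

/-- The natural map from the left boundary tube algebra: a trivial right arc is added. -/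
def lToTube : LTube C →ₗ[ℂ] Tube C :=
  DirectSum.toModule ℂ (LLabel C) _ fun t =>
    resolve t.a.obj (𝟙_ C) t.d t.e t.f t.g ∘ₗ
      TensorProduct.map
        (Linear.rightComp ℂ t.d.obj (ρ_ (t.a.obj ⊗ t.e.obj)).inv)
        (Linear.leftComp ℂ t.g.obj (ρ_ (t.a.obj ⊗ t.f.obj)).hom)

/-- The natural map from the right boundary tube algebra: a trivial left arc is added. -/
def rToTube : RTube C →ₗ[ℂ] Tube C :=
  DirectSum.toModule ℂ (RLabel C) _ fun t =>
    resolve (𝟙_ C) t.b.obj t.c t.e t.f t.h ∘ₗ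
      TensorProduct.map
        (Linear.rightComp ℂ t.c.obj ((λ_ t.e.obj).inv ▷ t.b.obj))
        (Linear.leftComp ℂ t.h.obj ((λ_ t.f.obj).hom ▷ t.b.obj))

/-- The simple summands of the tensor unit. -/
def IsUnitLabel (x : Irr C) : Prop := ∃ f : 𝟙_ C ⟶ x.obj, f ≠ 0

variable (C)

/-- The span of the bulk diagrams with trivial right arc. -/
def leftPart : Submodule ℂ (Tube C) :=
  Submodule.span ℂ {X | ∃ (a b c d e f g h : Irr C) (μ : c.obj ⟶ d.obj ⊗ b.obj)
    (ν : d.obj ⟶ a.obj ⊗ e.obj) (ζ : a.obj ⊗ f.obj ⟶ g.obj) (γ : g.obj ⊗ b.obj ⟶ h.obj),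
    IsUnitLabel b ∧ X = diagram μ ν ζ γ}

/-- The span of the bulk diagrams with trivial left arc. -/
def rightPart : Submodule ℂ (Tube C) :=
  Submodule.span ℂ {X | ∃ (a b c d e f g h : Irr C) (μ : c.obj ⟶ d.obj ⊗ b.obj)
    (ν : d.obj ⟶ a.obj ⊗ e.obj) (ζ : a.obj ⊗ f.obj ⟶ g.obj) (γ : g.obj ⊗ b.obj ⟶ h.obj),
    IsUnitLabel a ∧ X = diagram μ ν ζ γ}

variable {C}

/-- `x` and `y` lie in the same column `⊕ᵢ C_{i,j}` of the canonical grading. -/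
def SameColumn (x y : Irr C) : Prop :=
  ∃ j : Irr C, IsUnitLabel j ∧ ¬ IsZero (x.obj ⊗ j.obj) ∧ ¬ IsZero (y.obj ⊗ j.obj)

/-- `x` and `y` lie in the same row `⊕ⱼ C_{i,j}` of the canonical grading. -/
def SameRow (x y : Irr C) : Prop :=
  ∃ i : Irr C, IsUnitLabel i ∧ ¬ IsZero (i.obj ⊗ x.obj) ∧ ¬ IsZero (i.obj ⊗ y.obj)

variable (C)

/-- The span of the left boundary diagrams whose upper and lower edges lie in different columns. -/
def lMismatch : Submodule ℂ (LTube C) :=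
  Submodule.span ℂ {l | ∃ (a d e f g : Irr C) (ν : d.obj ⟶ a.obj ⊗ e.obj)
    (ζ : a.obj ⊗ f.obj ⟶ g.obj), ¬ SameColumn d g ∧ l = lDiagram ν ζ}

/-- The span of the right boundary diagrams whose upper and lower edges lie in different rows. -/
def rMismatch : Submodule ℂ (RTube C) :=
  Submodule.span ℂ {r | ∃ (b c d g h : Irr C) (μ : c.obj ⟶ d.obj ⊗ b.obj)
    (γ : g.obj ⊗ b.obj ⟶ h.obj), ¬ SameRow c h ∧ r = rDiagram μ γ}

/-! ### The crossed product -/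

/-- The relations of the crossed product: `r ⊗ l` vanishes unless the inner edges of the right
diagram `r` carry the same labels as the outer edges of the left diagram `l`. -/
def gluingRelations : Submodule ℂ (RTube C ⊗[ℂ] LTube C) :=
  Submodule.span ℂ {z | ∃ (t : RLabel C) (s : LLabel C) (x : t.Low ⊗[ℂ] t.Up)
    (y : s.Low ⊗[ℂ] s.Up), (t.e ≠ s.d ∨ t.f ≠ s.g) ∧ z = rOf t x ⊗ₜ[ℂ] lOf s y}

instance : AddCommGroup (RTube C ⊗[ℂ] LTube C) := TensorProduct.addCommGroup

/-- The underlying space of the crossed product of the right and the left boundary tube algebra. -/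
abbrev CrossedProduct : Type _ := (RTube C ⊗[ℂ] LTube C) ⧸ gluingRelations C

variable {C}

/-- The class of `r ⊗ l` in the crossed product. -/
def cross (r : RTube C) (l : LTube C) : CrossedProduct C :=
  (gluingRelations C).mkQ (r ⊗ₜ[ℂ] l)

/-- Lower half of a right diagram `s` put inside a left diagram `t`, rebracketed. -/
def exLow (t : LLabel C) (s : RLabel C) : t.Low →ₗ[ℂ] s.Low →ₗ[ℂ]
    (t.d.obj ⟶ (t.a.obj ⊗ s.e.obj) ⊗ s.b.obj) :=
  LinearMap.mk₂ ℂ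
    (fun p p' => p ≫ t.a.obj ◁ (edge t.e s.c ≫ p') ≫ (α_ _ _ _).inv)
    (by intros; simp) (by intros; simp) (by intros; simp) (by intros; simp)

/-- Upper half of a right diagram `s` put inside a left diagram `t`, rebracketed. -/
def exUp (t : LLabel C) (s : RLabel C) : t.Up →ₗ[ℂ] s.Up →ₗ[ℂ]
    ((t.a.obj ⊗ s.f.obj) ⊗ s.b.obj ⟶ t.g.obj) :=
  LinearMap.mk₂ ℂ
    (fun q q' => (α_ _ _ _).hom ≫ t.a.obj ◁ (q' ≫ edge s.h t.f) ≫ q)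
    (by intros; simp) (by intros; simp) (by intros; simp) (by intros; simp)

/-- F-moves: a diagram with inner left arc `a` and outer right arc `b` is expanded in the tree
bases, and is cut into right diagrams (outside) and left diagrams (inside). -/
def cut (a b d e f g : Irr C) :
    (d.obj ⟶ (a.obj ⊗ e.obj) ⊗ b.obj) ⊗[ℂ] ((a.obj ⊗ f.obj) ⊗ b.obj ⟶ g.obj) →ₗ[ℂ]
      RTube C ⊗[ℂ] LTube C :=
  ∑ m : Fin (decomp (a.obj ⊗ e.obj)).n, ∑ n : Fin (decomp (a.obj ⊗ f.obj)).n,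
    let D := decomp (a.obj ⊗ e.obj)
    let U := decomp (a.obj ⊗ f.obj)
    (TensorProduct.mk ℂ (RTube C) (LTube C)).flip
        (lDiagram (D.incl m) (U.proj n)) ∘ₗ
      rOf ⟨b, d, D.label m, U.label n, g⟩ ∘ₗ
        TensorProduct.map
          (Linear.rightComp ℂ d.obj (D.proj m ▷ b.obj))
          (Linear.leftComp ℂ g.obj (U.incl n ▷ b.obj))

/-- The exchange map: a right diagram inside a left diagram is rewritten by F-moves as a sum of
left diagrams inside right diagrams. -/
def exchange : LTube C →ₗ[ℂ] RTube C →ₗ[ℂ] RTube C ⊗[ℂ] LTube C :=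
  DirectSum.toModule ℂ (LLabel C) _ fun t =>
    (DirectSum.toModule ℂ (RLabel C) _ fun s =>
      ((TensorProduct.map₂ (exLow t s) (exUp t s)).compr₂
        (cut t.a s.b t.d s.e s.f t.g)).flip).flip

/-- `(r ⊗ l) (r' ⊗ l') = ∑ r r'' ⊗ l'' l'`, where `∑ r'' ⊗ l''` is the exchange of `l ⊗ r'`. -/
def preMul : RTube C ⊗[ℂ] LTube C →ₗ[ℂ] RTube C ⊗[ℂ] LTube C →ₗ[ℂ] RTube C ⊗[ℂ] LTube C :=
  TensorProduct.lift
    (LinearMap.mk₂ ℂ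
      (fun r l => TensorProduct.lift
        (LinearMap.mk₂ ℂ
          (fun r' l' => TensorProduct.map (rMul r) (lMul.flip l') (exchange l r'))
          (by intros; simp)
          (by intros; simp)
          (by intros; simp [TensorProduct.map_add_right])
          (by intros; simp [TensorProduct.map_smul_right])))
      (by intros; ext; simp [TensorProduct.map_add_left])
      (by intros; ext; simp [TensorProduct.map_smul_left])
      (by intros; ext; simp)
      (by intros; ext; simp))

/-- The comultiplication `r ⊗ l ↦ ∑ [r₁ ⊗ l₁] ⊗ [r₂ ⊗ l₂]`. -/
def preComul : RTube C ⊗[ℂ] LTube C →ₗ[ℂ] CrossedProduct C ⊗[ℂ] CrossedProduct C :=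
  TensorProduct.map (gluingRelations C).mkQ (gluingRelations C).mkQ ∘ₗ
    (TensorProduct.tensorTensorTensorComm ℂ (RTube C) (RTube C) (LTube C) (LTube C)).toLinearMap ∘ₗ
      TensorProduct.map rComul lComul

theorem map₂_eq_zero {M M' N N' P Q : Type*} [AddCommGroup M] [AddCommGroup M'] [AddCommGroup N]
    [AddCommGroup N'] [AddCommGroup P] [AddCommGroup Q] [Module ℂ M] [Module ℂ M'] [Module ℂ N]
    [Module ℂ N'] [Module ℂ P] [Module ℂ Q] (f : M →ₗ[ℂ] M' →ₗ[ℂ] P) (g : N →ₗ[ℂ] N' →ₗ[ℂ] Q)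
    (h : f = 0 ∨ g = 0) : TensorProduct.map₂ f g = 0 := by
  ext m n m' n'
  rcases h with rfl | rfl <;> simp

theorem rMul_of_ne {t t' : RLabel C} (h : t.e ≠ t'.c ∨ t.f ≠ t'.h) (x : t.Low ⊗[ℂ] t.Up)
    (y : t'.Low ⊗[ℂ] t'.Up) : rMul (rOf t x) (rOf t' y) = 0 := by
  have h0 : TensorProduct.map₂ (rLowStack t t') (rUpStack t t') = 0 := by
    apply map₂_eq_zero
    rcases h with h | h
    · left
      ext p p'
      simp [rLowStack, edge_of_ne h]
    · right
      ext q q'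
      simp [rUpStack, edge_of_ne (Ne.symm h)]
  simp [rMul, rOf, h0]

theorem lMul_of_ne {t t' : LLabel C} (h : t.e ≠ t'.d ∨ t.f ≠ t'.g) (x : t.Low ⊗[ℂ] t.Up)
    (y : t'.Low ⊗[ℂ] t'.Up) : lMul (lOf t x) (lOf t' y) = 0 := by
  have h0 : TensorProduct.map₂ (lLowStack t t') (lUpStack t t') = 0 := by
    apply map₂_eq_zero
    rcases h with h | h
    · left
      ext p p'
      simp [lLowStack, edge_of_ne h]
    · right
      ext q q'
      simp [lUpStack, edge_of_ne (Ne.symm h)]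
  simp [lMul, lOf, h0]

theorem preMul_tmul (r r' : RTube C) (l l' : LTube C) :
    preMul (r ⊗ₜ[ℂ] l) (r' ⊗ₜ[ℂ] l') = TensorProduct.map (rMul r) (lMul.flip l') (exchange l r') :=
  rfl

theorem map_exchange_left {t : RLabel C} {s : LLabel C} (h : t.e ≠ s.d ∨ t.f ≠ s.g)
    (x : t.Low ⊗[ℂ] t.Up) (y : s.Low ⊗[ℂ] s.Up) (w : RLabel C) (z : w.Low ⊗[ℂ] w.Up)
    (l' : LTube C) :
    TensorProduct.map (rMul (rOf t x)) (lMul.flip l') (exchange (lOf s y) (rOf w z)) = 0 := by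
  simp only [exchange, cut, rOf, lOf, DirectSum.toModule_lof, LinearMap.flip_apply,
    LinearMap.compr₂_apply, LinearMap.sum_apply, LinearMap.comp_apply, TensorProduct.mk_apply,
    map_sum, TensorProduct.map_tmul]
  refine Finset.sum_eq_zero fun m _ => Finset.sum_eq_zero fun n _ => ?_
  rw [rMul_of_ne (t' := ⟨_, _, _, _, _⟩) h, TensorProduct.zero_tmul]

theorem map_exchange_right {t : RLabel C} {s : LLabel C} (h : t.e ≠ s.d ∨ t.f ≠ s.g)
    (x : t.Low ⊗[ℂ] t.Up) (y : s.Low ⊗[ℂ] s.Up) (w : LLabel C) (z : w.Low ⊗[ℂ] w.Up)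
    (r : RTube C) :
    TensorProduct.map (rMul r) (lMul.flip (lOf s y)) (exchange (lOf w z) (rOf t x)) = 0 := by
  simp only [exchange, cut, rOf, lOf, DirectSum.toModule_lof, LinearMap.flip_apply,
    LinearMap.compr₂_apply, LinearMap.sum_apply, LinearMap.comp_apply, TensorProduct.mk_apply,
    map_sum, TensorProduct.map_tmul, lDiagram]
  refine Finset.sum_eq_zero fun m _ => Finset.sum_eq_zero fun n _ => ?_
  rw [lMul_of_ne (t := ⟨_, _, _, _, _⟩) h, TensorProduct.tmul_zero]

theorem preMul_left {z : RTube C ⊗[ℂ] LTube C} (hz : z ∈ gluingRelations C) : preMul z = 0 := by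
  have : gluingRelations C ≤ LinearMap.ker (preMul (C := C)) := by
    refine Submodule.span_le.2 ?_
    rintro _ ⟨t, s, x, y, h, rfl⟩
    rw [SetLike.mem_coe, LinearMap.mem_ker]
    refine TensorProduct.ext' fun r' l' => ?_
    rw [preMul_tmul, LinearMap.zero_apply]
    induction r' using DirectSum.induction_on with
    | zero => simp
    | of w z => exact map_exchange_left h x y w z l'
    | add a b ha hb => rw [map_add, map_add, ha, hb, add_zero]
  exact this hz

theorem preMul_right (z : RTube C ⊗[ℂ] LTube C) {z' : RTube C ⊗[ℂ] LTube C}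
    (hz : z' ∈ gluingRelations C) : preMul z z' = 0 := by
  have : gluingRelations C ≤ LinearMap.ker (preMul z) := by
    refine Submodule.span_le.2 ?_
    rintro _ ⟨t, s, x, y, h, rfl⟩
    rw [SetLike.mem_coe, LinearMap.mem_ker]
    induction z using TensorProduct.induction_on with
    | zero => simp
    | add a b ha hb => rw [map_add, LinearMap.add_apply, ha, hb, add_zero]
    | tmul r l =>
      rw [preMul_tmul]
      induction l using DirectSum.induction_on with
      | zero => simp
      | of w z => exact map_exchange_right h x y w z r
      | add a b ha hb => rw [map_add, LinearMap.add_apply, map_add, ha, hb, add_zero]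
  exact this hz

theorem mkQ_of_ne {t : RLabel C} {s : LLabel C} (h : t.e ≠ s.d ∨ t.f ≠ s.g)
    (x : t.Low ⊗[ℂ] t.Up) (y : s.Low ⊗[ℂ] s.Up) :
    (gluingRelations C).mkQ (rOf t x ⊗ₜ[ℂ] lOf s y) = 0 :=
  (Submodule.Quotient.mk_eq_zero _).2 (Submodule.subset_span ⟨t, s, x, y, h, rfl⟩)

theorem tmul_eq_zero_right (x y : CrossedProduct C) (h : y = 0) : x ⊗ₜ[ℂ] y = 0 := by
  rw [h, TensorProduct.tmul_zero]

theorem tmul_eq_zero_left (x y : CrossedProduct C) (h : x = 0) : x ⊗ₜ[ℂ] y = 0 := by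
  rw [h, TensorProduct.zero_tmul]

theorem preComul_relations : gluingRelations C ≤ LinearMap.ker (preComul (C := C)) := by
  refine Submodule.span_le.2 ?_
  rintro _ ⟨t, s, x, y, h, rfl⟩
  rw [SetLike.mem_coe, LinearMap.mem_ker]
  induction x using TensorProduct.induction_on with
  | zero => simp
  | add a b ha hb => rw [map_add, TensorProduct.add_tmul, map_add, ha, hb, add_zero]
  | tmul μ γ =>
  induction y using TensorProduct.induction_on with
  | zero => simp
  | add a b ha hb => rw [map_add, TensorProduct.tmul_add, map_add, ha, hb, add_zero]
  | tmul ν ζ =>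
  simp only [preComul, LinearMap.comp_apply, TensorProduct.map_tmul, rComul, lComul, rOf, lOf,
    DirectSum.toModule_lof, LinearMap.sum_apply, LinearEquiv.coe_coe, TensorProduct.comm_tmul,
    TensorProduct.mk_apply, LinearMap.flip_apply, TensorProduct.sum_tmul, TensorProduct.tmul_sum,
    map_sum, TensorProduct.tensorTensorTensorComm_tmul]
  refine Finset.sum_eq_zero fun _ _ => Finset.sum_eq_zero fun _ _ =>
    Finset.sum_eq_zero fun _ _ => Finset.sum_eq_zero fun _ _ => ?_
  rcases h with h | h
  · refine tmul_eq_zero_right _ _ ?_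
    apply mkQ_of_ne
    exact Or.inl h
  · refine tmul_eq_zero_left _ _ ?_
    apply mkQ_of_ne
    exact Or.inr h

/-- Multiplication of the crossed product. -/
def crossMul : CrossedProduct C →ₗ[ℂ] CrossedProduct C →ₗ[ℂ] CrossedProduct C :=
  (gluingRelations C).liftQ
    ((gluingRelations C).liftQ (preMul.compr₂ (gluingRelations C).mkQ).flip (by
      intro z hz
      refine LinearMap.ext fun w => ?_
      simp [preMul_right w hz])).flip
    (by
      intro z hz
      refine LinearMap.mem_ker.2 (LinearMap.ext fun w => ?_)
      obtain ⟨w, rfl⟩ := (gluingRelations C).mkQ_surjective w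
      change (gluingRelations C).mkQ (preMul z w) = 0
      rw [preMul_left hz, LinearMap.zero_apply, map_zero])

/-- The unit of the crossed product. -/
def crossOne : CrossedProduct C := cross rOne lOne

/-- Comultiplication of the crossed product. -/
def crossComul : CrossedProduct C →ₗ[ℂ] CrossedProduct C ⊗[ℂ] CrossedProduct C :=
  (gluingRelations C).liftQ preComul preComul_relations

end Algebra

/-- The bilinear map `mul` and the element `one` make `A` a unital associative algebra. -/
structure IsAlgebra {A : Type*} [AddCommGroup A] [Module ℂ A] (mul : A →ₗ[ℂ] A →ₗ[ℂ] A)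
    (one : A) : Prop where
  assoc : ∀ x y z, mul (mul x y) z = mul x (mul y z)
  one_mul : ∀ x, mul one x = x
  mul_one : ∀ x, mul x one = x

end TubeAlgebra

end

/-!
Diagrams may carry arbitrary objects on their arcs: `arc A B p q` has halves `p` and `q` and arcs
`A`, `B`, and it is turned into an element of the tube algebra by decomposing the arcs into simple
objects. A morphism slides along an arc from the upper half to the lower one, since by Schur's lemma
a sum over dual bases does not depend on the side on which the morphism is applied. Hence
multiplication, comultiplication and counit have the same formulas on arbitrary arcs as on simple
ones, and two diagrams agree as soon as a structural isomorphism of the arcs matches their halves.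
Associativity, the unit laws and the compatibilities of `ι_L` and `ι_R` are then coherence.

Gluing is `r ⊗ l ↦ ι_R(r) ι_L(l)`. Its inverse cuts a bulk diagram along the edges between the right
and the left arc, inserting a resolution of the identity on each of them, so the algebra laws of the
crossed product are transported from the bulk.

For the kernel of `ι_L`, contract the trivial right arc with `𝟙`. The composite with `ι_L` lets the
idempotents of the simple summands of `𝟙` act on the two outer edges. Since `End(𝟙)` is commutative,
these summands are pairwise non-isomorphic, and exactly one of the idempotents acts on a given
simple object as `1` and all others as `0`; this is the column of the object. So the composite is
the identity on diagrams whose outer edges lie in the same column, and `ι_L` kills all others.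
-/

noncomputable section

namespace TubeAlgebra

section Schur

variable {C : Type u} [Category.{v} C] [Abelian C]

instance (x : Irr C) : Simple x.obj := x.2

@[simp]
theorem edge_self (x : Irr C) : edge x x = 𝟙 x.obj := by
  simp [edge]

theorem hom_eq_zero_of_ne {x y : Irr C} (h : x ≠ y) (f : x.obj ⟶ y.obj) : f = 0 := by
  by_contra hf
  have : IsIso f := isIso_of_hom_simple hf
  refine h (Subtype.ext ?_)
  rw [← Quotient.out_eq x.1, ← Quotient.out_eq y.1]
  exact Quotient.sound ⟨@asIso _ _ _ _ f this⟩

end Schur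

variable {C : Type u} [Category.{v} C] [Abelian C] [Linear ℂ C]
  [MonoidalCategory C] [MonoidalPreadditive C] [MonoidalLinear ℂ C]

section Bilinear

variable {A A' B B' : C} {c e f h : Irr C}

theorem isBilinearMap_tubeOf_left (x y : Irr C) (p : c.obj ⟶ (A ⊗ e.obj) ⊗ B)
    (q : (A' ⊗ f.obj) ⊗ B' ⟶ h.obj) (m : B ⟶ y.obj) (n : y.obj ⟶ B') :
    IsBilinearMap ℂ fun (u : A ⟶ x.obj) (w : x.obj ⟶ A') => tubeOf ⟨x, y, c, e, f, h⟩
      ((p ≫ (u ▷ e.obj ⊗ₘ m)) ⊗ₜ[ℂ] ((w ▷ f.obj ⊗ₘ n) ≫ q)) := by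
  constructor <;> simp [MonoidalCategory.tensorHom_def,
    TensorProduct.add_tmul, TensorProduct.tmul_add, TensorProduct.smul_tmul]

theorem isBilinearMap_tubeOf_right (x y : Irr C) (p : c.obj ⟶ (A ⊗ e.obj) ⊗ B)
    (q : (A' ⊗ f.obj) ⊗ B' ⟶ h.obj) (m : A ⟶ x.obj) (n : x.obj ⟶ A') :
    IsBilinearMap ℂ fun (u : B ⟶ y.obj) (w : y.obj ⟶ B') => tubeOf ⟨x, y, c, e, f, h⟩
      ((p ≫ (m ▷ e.obj ⊗ₘ u)) ⊗ₜ[ℂ] ((n ▷ f.obj ⊗ₘ w) ≫ q)) := by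
  constructor <;> simp [MonoidalCategory.tensorHom_def,
    TensorProduct.add_tmul, TensorProduct.tmul_add, TensorProduct.smul_tmul]

end Bilinear

variable [RigidCategory C] [MultifusionCategory C] {V : Type*} [AddCommGroup V] [Module ℂ V]

theorem exists_eq_smul_id {x : Irr C} (f : x.obj ⟶ x.obj) : ∃ r : ℂ, f = r • 𝟙 x.obj := by
  have : FiniteDimensional ℂ (x.obj ⟶ x.obj) := MultifusionCategory.finiteDimensional_hom _ _
  obtain ⟨r, hr⟩ := endomorphism_simple_eq_smul_id ℂ f
  exact ⟨r, hr.symm⟩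

section DualBases

variable {Z Z' : C}

theorem map_comp_eq_of_isBilinearMap {Ψ : ∀ x : Irr C, (Z ⟶ x.obj) → (x.obj ⟶ Z') → V}
    (hΨ : ∀ x, IsBilinearMap ℂ (Ψ x)) {x y : Irr C} (k : Z ⟶ x.obj) (g : x.obj ⟶ y.obj)
    (l : y.obj ⟶ Z') : Ψ x k (g ≫ l) = Ψ y (k ≫ g) l := by
  by_cases h : x = y
  · subst h
    obtain ⟨r, rfl⟩ := exists_eq_smul_id g
    simp [(hΨ x).smul_left, (hΨ x).smul_right]
  · have zero_right : Ψ x k 0 = 0 := by simpa using (hΨ x).smul_right 0 k 0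
    have zero_left : Ψ y 0 l = 0 := by simpa using (hΨ y).smul_left 0 0 l
    rw [hom_eq_zero_of_ne h g, zero_comp, comp_zero, zero_left, zero_right]

theorem SimpleDecomp.sum_comp (D : SimpleDecomp Z) (D' : SimpleDecomp Z') (f : Z ⟶ Z')
    {Ψ : ∀ x : Irr C, (Z ⟶ x.obj) → (x.obj ⟶ Z') → V} (hΨ : ∀ x, IsBilinearMap ℂ (Ψ x)) :
    ∑ i, Ψ (D.label i) (D.proj i) (D.incl i ≫ f) =
      ∑ j, Ψ (D'.label j) (f ≫ D'.proj j) (D'.incl j) := by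
  have expand (i) : D.incl i ≫ f = ∑ j, (D.incl i ≫ f ≫ D'.proj j) ≫ D'.incl j := by
    simp only [Category.assoc, ← Preadditive.comp_sum, D'.total, Category.comp_id]
  have collect (j) : f ≫ D'.proj j = ∑ i, D.proj i ≫ D.incl i ≫ f ≫ D'.proj j := by
    simp only [← Category.assoc, ← Preadditive.sum_comp, D.total, Category.id_comp]
  calc ∑ i, Ψ (D.label i) (D.proj i) (D.incl i ≫ f)
      = ∑ i, ∑ j, Ψ (D.label i) (D.proj i) ((D.incl i ≫ f ≫ D'.proj j) ≫ D'.incl j) :=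
        Finset.sum_congr rfl fun i _ => by
          rw [expand i]
          exact map_sum ((hΨ _).toLinearMap (D.proj i)) _ _
    _ = ∑ j, ∑ i, Ψ (D'.label j) (D.proj i ≫ D.incl i ≫ f ≫ D'.proj j) (D'.incl j) := by
        rw [Finset.sum_comm]
        simp only [map_comp_eq_of_isBilinearMap hΨ]
    _ = ∑ j, Ψ (D'.label j) (f ≫ D'.proj j) (D'.incl j) :=
        Finset.sum_congr rfl fun j _ =>
          (map_sum ((hΨ _).toLinearMap.flip (D'.incl j)) _ _).symm.trans
            (congrArg (Ψ _ · (D'.incl j)) (collect j).symm)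

theorem SimpleDecomp.sum_comp_proj {z : Irr C} (D : SimpleDecomp Z') (f : z.obj ⟶ Z')
    {Ψ : ∀ x : Irr C, (z.obj ⟶ x.obj) → (x.obj ⟶ Z') → V} (hΨ : ∀ x, IsBilinearMap ℂ (Ψ x)) :
    ∑ j, Ψ (D.label j) (f ≫ D.proj j) (D.incl j) = Ψ z (𝟙 _) f := by
  calc ∑ j, Ψ (D.label j) (f ≫ D.proj j) (D.incl j)
      = ∑ j, Ψ z (𝟙 _) ((f ≫ D.proj j) ≫ D.incl j) := by
        simp only [map_comp_eq_of_isBilinearMap hΨ, Category.id_comp]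
    _ = Ψ z (𝟙 _) (∑ j, (f ≫ D.proj j) ≫ D.incl j) :=
        (map_sum ((hΨ z).toLinearMap (𝟙 _)) _ _).symm
    _ = Ψ z (𝟙 _) f := by
        simp only [Category.assoc, ← Preadditive.comp_sum, D.total, Category.comp_id]

theorem SimpleDecomp.sum_incl_comp {z : Irr C} (D : SimpleDecomp Z) (f : Z ⟶ z.obj)
    {Ψ : ∀ x : Irr C, (Z ⟶ x.obj) → (x.obj ⟶ z.obj) → V} (hΨ : ∀ x, IsBilinearMap ℂ (Ψ x)) :
    ∑ i, Ψ (D.label i) (D.proj i) (D.incl i ≫ f) = Ψ z f (𝟙 _) := by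
  calc ∑ i, Ψ (D.label i) (D.proj i) (D.incl i ≫ f)
      = ∑ i, Ψ z (D.proj i ≫ D.incl i ≫ f) (𝟙 _) := by
        simp only [← map_comp_eq_of_isBilinearMap hΨ, Category.comp_id]
    _ = Ψ z (∑ i, D.proj i ≫ D.incl i ≫ f) (𝟙 _) :=
        (map_sum ((hΨ z).toLinearMap.flip (𝟙 _)) _ _).symm
    _ = Ψ z f (𝟙 _) := by
        simp only [← Category.assoc, ← Preadditive.sum_comp, D.total, Category.id_comp]

end DualBases

/-! ### Diagrams whose arcs carry arbitrary objects -/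

section Arc

variable {A A' B B' : C} {a b c d e f g h : Irr C}

/-- The bulk diagram with halves `p` and `q` whose arcs carry arbitrary objects `A` and `B`. -/
def arc (A B : C) {c e f h : Irr C} (p : c.obj ⟶ (A ⊗ e.obj) ⊗ B) (q : (A ⊗ f.obj) ⊗ B ⟶ h.obj) :
    Tube C :=
  resolve A B c e f h (p ⊗ₜ[ℂ] q)

/-- The left boundary diagram with halves `p` and `q` whose arc carries an arbitrary object `A`. -/
def lArc (A : C) {d e f g : Irr C} (p : d.obj ⟶ A ⊗ e.obj) (q : A ⊗ f.obj ⟶ g.obj) : LTube C :=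
  lResolve A d e f g (p ⊗ₜ[ℂ] q)

/-- The right boundary diagram with halves `p` and `q` whose arc carries an arbitrary object `B`. -/
def rArc (B : C) {c e f h : Irr C} (p : c.obj ⟶ e.obj ⊗ B) (q : f.obj ⊗ B ⟶ h.obj) : RTube C :=
  rResolve B c e f h (p ⊗ₜ[ℂ] q)

theorem arc_eq_sum (p : c.obj ⟶ (A ⊗ e.obj) ⊗ B) (q : (A ⊗ f.obj) ⊗ B ⟶ h.obj) :
    arc A B p q = ∑ i, ∑ j, tubeOf ⟨(decomp A).label i, (decomp B).label j, c, e, f, h⟩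
      ((p ≫ (((decomp A).proj i ▷ e.obj) ⊗ₘ (decomp B).proj j)) ⊗ₜ[ℂ]
        ((((decomp A).incl i ▷ f.obj) ⊗ₘ (decomp B).incl j) ≫ q)) := by
  simp [arc, resolve]

theorem lArc_eq_sum (p : d.obj ⟶ A ⊗ e.obj) (q : A ⊗ f.obj ⟶ g.obj) :
    lArc A p q = ∑ i, lOf ⟨(decomp A).label i, d, e, f, g⟩
      ((p ≫ (decomp A).proj i ▷ e.obj) ⊗ₜ[ℂ] ((decomp A).incl i ▷ f.obj ≫ q)) := by
  simp [lArc, lResolve]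

theorem rArc_eq_sum (p : c.obj ⟶ e.obj ⊗ B) (q : f.obj ⊗ B ⟶ h.obj) :
    rArc B p q = ∑ j, rOf ⟨(decomp B).label j, c, e, f, h⟩
      ((p ≫ e.obj ◁ (decomp B).proj j) ⊗ₜ[ℂ] (f.obj ◁ (decomp B).incl j ≫ q)) := by
  simp [rArc, rResolve]

theorem lArc_dinatural (k : A ⟶ A') (p : d.obj ⟶ A ⊗ e.obj) (q : A' ⊗ f.obj ⟶ g.obj) :
    lArc A' (p ≫ k ▷ e.obj) q = lArc A p (k ▷ f.obj ≫ q) := by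
  have := SimpleDecomp.sum_comp (decomp A) (decomp A') k
    (Ψ := fun x u w => lOf ⟨x, d, e, f, g⟩ ((p ≫ u ▷ e.obj) ⊗ₜ[ℂ] (w ▷ f.obj ≫ q))) fun x => by
      constructor <;> simp [TensorProduct.add_tmul, TensorProduct.tmul_add, TensorProduct.smul_tmul]
  simpa only [lArc_eq_sum, Category.assoc, comp_whiskerRight] using this.symm

theorem rArc_dinatural (k : B ⟶ B') (p : c.obj ⟶ e.obj ⊗ B) (q : f.obj ⊗ B' ⟶ h.obj) :
    rArc B' (p ≫ e.obj ◁ k) q = rArc B p (f.obj ◁ k ≫ q) := by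
  have := SimpleDecomp.sum_comp (decomp B) (decomp B') k
    (Ψ := fun x u w => rOf ⟨x, c, e, f, h⟩ ((p ≫ e.obj ◁ u) ⊗ₜ[ℂ] (f.obj ◁ w ≫ q))) fun x => by
      constructor <;> simp [TensorProduct.add_tmul, TensorProduct.tmul_add, TensorProduct.smul_tmul]
  simpa only [rArc_eq_sum, Category.assoc, MonoidalCategory.whiskerLeft_comp] using this.symm

theorem arc_dinatural_left (k : A ⟶ A') (p : c.obj ⟶ (A ⊗ e.obj) ⊗ B)
    (q : (A' ⊗ f.obj) ⊗ B ⟶ h.obj) :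
    arc A' B (p ≫ (k ▷ e.obj) ▷ B) q = arc A B p ((k ▷ f.obj) ▷ B ≫ q) := by
  have slide := fun j => SimpleDecomp.sum_comp (decomp A) (decomp A') k fun x =>
    isBilinearMap_tubeOf_left x _ p q ((decomp B).proj j) ((decomp B).incl j)
  rw [arc_eq_sum, Finset.sum_comm, eq_comm, arc_eq_sum, Finset.sum_comm]
  refine Finset.sum_congr rfl fun j _ => ?_
  simpa only [Category.assoc, whiskerRight_comp_tensorHom, tensorHom_comp_whiskerRight_assoc,
    comp_whiskerRight] using slide j

theorem arc_dinatural_right (l : B ⟶ B') (p : c.obj ⟶ (A ⊗ e.obj) ⊗ B)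
    (q : (A ⊗ f.obj) ⊗ B' ⟶ h.obj) :
    arc A B' (p ≫ (A ⊗ e.obj) ◁ l) q = arc A B p ((A ⊗ f.obj) ◁ l ≫ q) := by
  have slide := fun i => SimpleDecomp.sum_comp (decomp B) (decomp B') l fun y =>
    isBilinearMap_tubeOf_right _ y p q ((decomp A).proj i) ((decomp A).incl i)
  rw [arc_eq_sum, arc_eq_sum]
  refine Finset.sum_congr rfl fun i _ => ?_
  simpa only [Category.assoc, whiskerLeft_comp_tensorHom, tensorHom_comp_whiskerLeft_assoc]
    using (slide i).symm

theorem arc_dinatural (k : A ⟶ A') (l : B ⟶ B') (p : c.obj ⟶ (A ⊗ e.obj) ⊗ B)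
    (q : (A' ⊗ f.obj) ⊗ B' ⟶ h.obj) :
    arc A' B' (p ≫ ((k ▷ e.obj) ⊗ₘ l)) q = arc A B p (((k ▷ f.obj) ⊗ₘ l) ≫ q) := by
  rw [MonoidalCategory.tensorHom_def, MonoidalCategory.tensorHom_def, ← Category.assoc,
    arc_dinatural_right, arc_dinatural_left, Category.assoc]

theorem lArc_simple (p : d.obj ⟶ a.obj ⊗ e.obj) (q : a.obj ⊗ f.obj ⟶ g.obj) :
    lArc a.obj p q = lOf ⟨a, d, e, f, g⟩ (p ⊗ₜ[ℂ] q) := by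
  have := SimpleDecomp.sum_comp_proj (decomp a.obj) (𝟙 _)
    (Ψ := fun x u w => lOf ⟨x, d, e, f, g⟩ ((p ≫ u ▷ e.obj) ⊗ₜ[ℂ] (w ▷ f.obj ≫ q))) fun x => by
      constructor <;> simp [TensorProduct.add_tmul, TensorProduct.tmul_add, TensorProduct.smul_tmul]
  simpa [lArc_eq_sum] using this

theorem rArc_simple (p : c.obj ⟶ e.obj ⊗ b.obj) (q : f.obj ⊗ b.obj ⟶ h.obj) :
    rArc b.obj p q = rOf ⟨b, c, e, f, h⟩ (p ⊗ₜ[ℂ] q) := by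
  have := SimpleDecomp.sum_comp_proj (decomp b.obj) (𝟙 _)
    (Ψ := fun x u w => rOf ⟨x, c, e, f, h⟩ ((p ≫ e.obj ◁ u) ⊗ₜ[ℂ] (f.obj ◁ w ≫ q))) fun x => by
      constructor <;> simp [TensorProduct.add_tmul, TensorProduct.tmul_add, TensorProduct.smul_tmul]
  simpa [rArc_eq_sum] using this

theorem arc_simple (p : c.obj ⟶ (a.obj ⊗ e.obj) ⊗ b.obj) (q : (a.obj ⊗ f.obj) ⊗ b.obj ⟶ h.obj) :
    arc a.obj b.obj p q = tubeOf ⟨a, b, c, e, f, h⟩ (p ⊗ₜ[ℂ] q) := by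
  have resolve_right := fun i => SimpleDecomp.sum_comp_proj (decomp b.obj) (𝟙 _) fun y =>
    isBilinearMap_tubeOf_right _ y p q ((decomp a.obj).proj i) ((decomp a.obj).incl i)
  have resolve_left := SimpleDecomp.sum_comp_proj (decomp a.obj) (𝟙 _) fun x =>
    isBilinearMap_tubeOf_left x b p q (𝟙 _) (𝟙 _)
  simp only [Category.id_comp] at resolve_right resolve_left
  rw [arc_eq_sum, Finset.sum_congr rfl fun i _ => resolve_right i, resolve_left]
  simp

theorem map_lArc (φ : LTube C →ₗ[ℂ] V) (F : ∀ A : C, (d.obj ⟶ A ⊗ e.obj) → (A ⊗ f.obj ⟶ g.obj) → V)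
    (F_simple : ∀ a p q, φ (lOf ⟨a, d, e, f, g⟩ (p ⊗ₜ[ℂ] q)) = F a.obj p q)
    (F_add : ∀ A p q q', F A p (q + q') = F A p q + F A p q')
    (F_dinatural : ∀ {A A'} (k : A ⟶ A') p q, F A' (p ≫ k ▷ e.obj) q = F A p (k ▷ f.obj ≫ q))
    (p : d.obj ⟶ A ⊗ e.obj) (q : A ⊗ f.obj ⟶ g.obj) : φ (lArc A p q) = F A p q := by
  have total : ∑ i, ((decomp A).proj i ≫ (decomp A).incl i) ▷ f.obj ≫ q = q := by
    rw [← Preadditive.sum_comp, ← sum_whiskerRight, (decomp A).total, id_whiskerRight,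
      Category.id_comp]
  rw [lArc_eq_sum, map_sum, ← congrArg (F A p) total]
  simp only [F_simple, F_dinatural, comp_whiskerRight, Category.assoc]
  exact (map_sum (AddMonoidHom.mk' (F A p) (F_add A p)) _ _).symm

theorem map_rArc (φ : RTube C →ₗ[ℂ] V) (F : ∀ B : C, (c.obj ⟶ e.obj ⊗ B) → (f.obj ⊗ B ⟶ h.obj) → V)
    (F_simple : ∀ b p q, φ (rOf ⟨b, c, e, f, h⟩ (p ⊗ₜ[ℂ] q)) = F b.obj p q)
    (F_add : ∀ B p q q', F B p (q + q') = F B p q + F B p q')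
    (F_dinatural : ∀ {B B'} (k : B ⟶ B') p q, F B' (p ≫ e.obj ◁ k) q = F B p (f.obj ◁ k ≫ q))
    (p : c.obj ⟶ e.obj ⊗ B) (q : f.obj ⊗ B ⟶ h.obj) : φ (rArc B p q) = F B p q := by
  have total : ∑ i, f.obj ◁ ((decomp B).proj i ≫ (decomp B).incl i) ≫ q = q := by
    rw [← Preadditive.sum_comp, ← whiskerLeft_sum, (decomp B).total, whiskerLeft_id,
      Category.id_comp]
  rw [rArc_eq_sum, map_sum, ← congrArg (F B p) total]
  simp only [F_simple, F_dinatural, MonoidalCategory.whiskerLeft_comp, Category.assoc]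
  exact (map_sum (AddMonoidHom.mk' (F B p) (F_add B p)) _ _).symm

theorem map_arc (φ : Tube C →ₗ[ℂ] V)
    (F : ∀ A B : C, (c.obj ⟶ (A ⊗ e.obj) ⊗ B) → ((A ⊗ f.obj) ⊗ B ⟶ h.obj) → V)
    (F_simple : ∀ a b p q, φ (tubeOf ⟨a, b, c, e, f, h⟩ (p ⊗ₜ[ℂ] q)) = F a.obj b.obj p q)
    (F_add : ∀ A B p q q', F A B p (q + q') = F A B p q + F A B p q')
    (F_dinatural : ∀ {A A' B B'} (k : A ⟶ A') (l : B ⟶ B') p q,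
      F A' B' (p ≫ (k ▷ e.obj ⊗ₘ l)) q = F A B p ((k ▷ f.obj ⊗ₘ l) ≫ q))
    (p : c.obj ⟶ (A ⊗ e.obj) ⊗ B) (q : (A ⊗ f.obj) ⊗ B ⟶ h.obj) :
    φ (arc A B p q) = F A B p q := by
  have total : ∑ i, ∑ j, (((decomp A).proj i ≫ (decomp A).incl i) ▷ f.obj ⊗ₘ
      (decomp B).proj j ≫ (decomp B).incl j) ≫ q = q := by
    simp only [← Preadditive.sum_comp, ← tensor_sum, ← sum_tensor, ← sum_whiskerRight,
      SimpleDecomp.total, id_whiskerRight, id_tensorHom_id, Category.id_comp]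
  have F_sum {n : ℕ} (q' : Fin n → ((A ⊗ f.obj) ⊗ B ⟶ h.obj)) :
      F A B p (∑ i, q' i) = ∑ i, F A B p (q' i) :=
    map_sum (AddMonoidHom.mk' (F A B p) (F_add A B p)) _ _
  rw [arc_eq_sum, ← congrArg (F A B p) total]
  simp only [map_sum, F_simple, F_dinatural, F_sum, comp_whiskerRight, ← tensorHom_comp_tensorHom,
    Category.assoc]

theorem lArc_congr (k : A ⟶ A') {p : d.obj ⟶ A ⊗ e.obj} {q : A ⊗ f.obj ⟶ g.obj}
    {p' : d.obj ⟶ A' ⊗ e.obj} {q' : A' ⊗ f.obj ⟶ g.obj} (low : p ≫ k ▷ e.obj = p')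
    (up : k ▷ f.obj ≫ q' = q) : lArc A p q = lArc A' p' q' := by
  rw [← low, ← up, lArc_dinatural]

theorem rArc_congr (k : B ⟶ B') {p : c.obj ⟶ e.obj ⊗ B} {q : f.obj ⊗ B ⟶ h.obj}
    {p' : c.obj ⟶ e.obj ⊗ B'} {q' : f.obj ⊗ B' ⟶ h.obj} (low : p ≫ e.obj ◁ k = p')
    (up : f.obj ◁ k ≫ q' = q) : rArc B p q = rArc B' p' q' := by
  rw [← low, ← up, rArc_dinatural]

theorem arc_congr (k : A ⟶ A') (l : B ⟶ B') {p : c.obj ⟶ (A ⊗ e.obj) ⊗ B}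
    {q : (A ⊗ f.obj) ⊗ B ⟶ h.obj} {p' : c.obj ⟶ (A' ⊗ e.obj) ⊗ B'}
    {q' : (A' ⊗ f.obj) ⊗ B' ⟶ h.obj} (low : p ≫ ((k ▷ e.obj) ⊗ₘ l) = p')
    (up : ((k ▷ f.obj) ⊗ₘ l) ≫ q' = q) : arc A B p q = arc A' B' p' q' := by
  rw [← low, ← up, arc_dinatural]

theorem LTube.hom_ext {φ ψ : LTube C →ₗ[ℂ] V}
    (H : ∀ (a d e f g : Irr C) (p : d.obj ⟶ a.obj ⊗ e.obj) (q : a.obj ⊗ f.obj ⟶ g.obj),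
      φ (lArc a.obj p q) = ψ (lArc a.obj p q)) : φ = ψ :=
  DirectSum.linearMap_ext _ fun t => TensorProduct.ext' fun p q => by
    simpa only [lArc_simple, LinearMap.comp_apply] using H t.a t.d t.e t.f t.g p q

theorem RTube.hom_ext {φ ψ : RTube C →ₗ[ℂ] V}
    (H : ∀ (b c e f h : Irr C) (p : c.obj ⟶ e.obj ⊗ b.obj) (q : f.obj ⊗ b.obj ⟶ h.obj),
      φ (rArc b.obj p q) = ψ (rArc b.obj p q)) : φ = ψ :=
  DirectSum.linearMap_ext _ fun t => TensorProduct.ext' fun p q => by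
    simpa only [rArc_simple, LinearMap.comp_apply] using H t.b t.c t.e t.f t.h p q

theorem Tube.hom_ext {φ ψ : Tube C →ₗ[ℂ] V}
    (H : ∀ (a b c e f h : Irr C) (p : c.obj ⟶ (a.obj ⊗ e.obj) ⊗ b.obj)
      (q : (a.obj ⊗ f.obj) ⊗ b.obj ⟶ h.obj),
      φ (arc a.obj b.obj p q) = ψ (arc a.obj b.obj p q)) : φ = ψ :=
  DirectSum.linearMap_ext _ fun t => TensorProduct.ext' fun p q => by
    simpa only [arc_simple, LinearMap.comp_apply] using H t.a t.b t.c t.e t.f t.h p q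

end Arc

section Nest

variable {C : Type u} [Category.{v} C] [MonoidalCategory C]

theorem nest_hom (A A' x B' B : C) : (nest A A' x B' B).hom =
    ((α_ A (A' ⊗ x) B').inv ≫ (α_ A A' x).inv ▷ B') ▷ B ≫ (α_ ((A ⊗ A') ⊗ x) B' B).hom := rfl

theorem nest_inv (A A' x B' B : C) : (nest A A' x B' B).inv =
    (α_ ((A ⊗ A') ⊗ x) B' B).inv ≫ ((α_ A A' x).hom ▷ B' ≫ (α_ A (A' ⊗ x) B').hom) ▷ B := rfl

theorem nest_naturality {A₁ A₂ A₁' A₂' B₁ B₂ B₁' B₂' x y : C} (k : A₁ ⟶ A₂) (k' : A₁' ⟶ A₂')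
    (m : x ⟶ y) (l' : B₁' ⟶ B₂') (l : B₁ ⟶ B₂) :
    ((k ⊗ₘ ((k' ⊗ₘ m) ⊗ₘ l')) ⊗ₘ l) ≫ (nest A₂ A₂' y B₂' B₂).hom =
      (nest A₁ A₁' x B₁' B₁).hom ≫ (((k ⊗ₘ k') ⊗ₘ m) ⊗ₘ (l' ⊗ₘ l)) := by
  simp only [nest_hom, ← tensorHom_id, tensorHom_comp_tensorHom_assoc, tensorHom_comp_tensorHom,
    Category.assoc, Category.comp_id, Category.id_comp, ← associator_naturality,
    associator_inv_naturality, associator_inv_naturality_assoc]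

theorem nest_inv_naturality {A₁ A₂ A₁' A₂' B₁ B₂ B₁' B₂' x y : C} (k : A₁ ⟶ A₂) (k' : A₁' ⟶ A₂')
    (m : x ⟶ y) (l' : B₁' ⟶ B₂') (l : B₁ ⟶ B₂) :
    (((k ⊗ₘ k') ⊗ₘ m) ⊗ₘ (l' ⊗ₘ l)) ≫ (nest A₂ A₂' y B₂' B₂).inv =
      (nest A₁ A₁' x B₁' B₁).inv ≫ ((k ⊗ₘ ((k' ⊗ₘ m) ⊗ₘ l')) ⊗ₘ l) := by
  rw [Iso.comp_inv_eq, Category.assoc, nest_naturality, Iso.inv_hom_id_assoc]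

end Nest

section Mul

variable {A A' B B' : C} {a b c d e f g h a' b' c' d' e' f' g' h' : Irr C}

theorem lMul_lArc_simple (p : d.obj ⟶ a.obj ⊗ e.obj) (q : a.obj ⊗ f.obj ⟶ g.obj)
    (p' : d'.obj ⟶ a'.obj ⊗ e'.obj) (q' : a'.obj ⊗ f'.obj ⟶ g'.obj) :
    lMul (lArc a.obj p q) (lArc a'.obj p' q') =
      lArc (a.obj ⊗ a'.obj) (p ≫ a.obj ◁ (edge e d' ≫ p') ≫ (α_ _ _ _).inv)
        ((α_ _ _ _).hom ≫ a.obj ◁ (q' ≫ edge g' f) ≫ q) := by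
  rw [lArc_simple, lArc_simple]
  simp [lMul, lArc, lLowStack, lUpStack]

theorem rMul_rArc_simple (p : c.obj ⟶ e.obj ⊗ b.obj) (q : f.obj ⊗ b.obj ⟶ h.obj)
    (p' : c'.obj ⟶ e'.obj ⊗ b'.obj) (q' : f'.obj ⊗ b'.obj ⟶ h'.obj) :
    rMul (rArc b.obj p q) (rArc b'.obj p' q') =
      rArc (b'.obj ⊗ b.obj) (p ≫ (edge e c' ≫ p') ▷ b.obj ≫ (α_ _ _ _).hom)
        ((α_ _ _ _).inv ≫ (q' ≫ edge h' f) ▷ b.obj ≫ q) := by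
  rw [rArc_simple, rArc_simple]
  simp [rMul, rArc, rLowStack, rUpStack]

theorem tubeMul_arc_simple (p : c.obj ⟶ (a.obj ⊗ e.obj) ⊗ b.obj)
    (q : (a.obj ⊗ f.obj) ⊗ b.obj ⟶ h.obj) (p' : c'.obj ⟶ (a'.obj ⊗ e'.obj) ⊗ b'.obj)
    (q' : (a'.obj ⊗ f'.obj) ⊗ b'.obj ⟶ h'.obj) :
    tubeMul (arc a.obj b.obj p q) (arc a'.obj b'.obj p' q') =
      arc (a.obj ⊗ a'.obj) (b'.obj ⊗ b.obj)
        (p ≫ (a.obj ◁ (edge e c' ≫ p')) ▷ b.obj ≫ (nest _ _ _ _ _).hom)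
        ((nest _ _ _ _ _).inv ≫ (a.obj ◁ (q' ≫ edge h' f)) ▷ b.obj ≫ q) := by
  rw [arc_simple, arc_simple]
  simp [tubeMul, arc, lowStack, upStack]

theorem lMul_lArc (p : d.obj ⟶ A ⊗ e.obj) (q : A ⊗ f.obj ⟶ g.obj) (p' : d'.obj ⟶ A' ⊗ e'.obj)
    (q' : A' ⊗ f'.obj ⟶ g'.obj) :
    lMul (lArc A p q) (lArc A' p' q') =
      lArc (A ⊗ A') (p ≫ A ◁ (edge e d' ≫ p') ≫ (α_ _ _ _).inv)
        ((α_ _ _ _).hom ≫ A ◁ (q' ≫ edge g' f) ≫ q) := by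
  refine map_lArc (lMul.flip (lArc A' p' q')) (fun A p q => lArc (A ⊗ A')
    (p ≫ A ◁ (edge e d' ≫ p') ≫ (α_ _ _ _).inv) ((α_ _ _ _).hom ≫ A ◁ (q' ≫ edge g' f) ≫ q))
    (fun a p q => ?_) (fun A p q₁ q₂ => ?_) (fun {A₁ A₂} k p q => ?_) p q
  · rw [← lArc_simple]
    refine map_lArc (lMul (lArc a.obj p q)) (fun A' p' q' => lArc (a.obj ⊗ A')
      (p ≫ a.obj ◁ (edge e d' ≫ p') ≫ (α_ _ _ _).inv)
      ((α_ _ _ _).hom ≫ a.obj ◁ (q' ≫ edge g' f) ≫ q))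
      (fun a' p' q' => ?_) (fun A' p' q₁ q₂ => ?_) (fun {A₁ A₂} k p' q' => ?_) p' q'
    · rw [← lArc_simple, lMul_lArc_simple]
    · simp [lArc, TensorProduct.tmul_add]
    · exact (lArc_congr (a.obj ◁ k) (by simp) (by simp)).symm
  · simp [lArc, TensorProduct.tmul_add]
  · exact (lArc_congr (k ▷ A') (by simp [← whisker_exchange_assoc])
      (by simp [whisker_exchange_assoc])).symm

theorem rMul_rArc (p : c.obj ⟶ e.obj ⊗ B) (q : f.obj ⊗ B ⟶ h.obj) (p' : c'.obj ⟶ e'.obj ⊗ B')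
    (q' : f'.obj ⊗ B' ⟶ h'.obj) :
    rMul (rArc B p q) (rArc B' p' q') =
      rArc (B' ⊗ B) (p ≫ (edge e c' ≫ p') ▷ B ≫ (α_ _ _ _).hom)
        ((α_ _ _ _).inv ≫ (q' ≫ edge h' f) ▷ B ≫ q) := by
  refine map_rArc (rMul.flip (rArc B' p' q')) (fun B p q => rArc (B' ⊗ B)
    (p ≫ (edge e c' ≫ p') ▷ B ≫ (α_ _ _ _).hom) ((α_ _ _ _).inv ≫ (q' ≫ edge h' f) ▷ B ≫ q))
    (fun b p q => ?_) (fun B p q₁ q₂ => ?_) (fun {B₁ B₂} k p q => ?_) p q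
  · rw [← rArc_simple]
    refine map_rArc (rMul (rArc b.obj p q)) (fun B' p' q' => rArc (B' ⊗ b.obj)
      (p ≫ (edge e c' ≫ p') ▷ b.obj ≫ (α_ _ _ _).hom)
      ((α_ _ _ _).inv ≫ (q' ≫ edge h' f) ▷ b.obj ≫ q))
      (fun b' p' q' => ?_) (fun B' p' q₁ q₂ => ?_) (fun {B₁ B₂} k p' q' => ?_) p' q'
    · rw [← rArc_simple, rMul_rArc_simple]
    · simp [rArc, TensorProduct.tmul_add]
    · exact (rArc_congr (k ▷ b.obj) (by simp) (by simp)).symm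
  · simp [rArc, TensorProduct.tmul_add]
  · exact (rArc_congr (B' ◁ k) (by simp [whisker_exchange_assoc])
      (by simp [← whisker_exchange_assoc])).symm

theorem tubeMul_arc (p : c.obj ⟶ (A ⊗ e.obj) ⊗ B) (q : (A ⊗ f.obj) ⊗ B ⟶ h.obj)
    (p' : c'.obj ⟶ (A' ⊗ e'.obj) ⊗ B') (q' : (A' ⊗ f'.obj) ⊗ B' ⟶ h'.obj) :
    tubeMul (arc A B p q) (arc A' B' p' q') =
      arc (A ⊗ A') (B' ⊗ B) (p ≫ (A ◁ (edge e c' ≫ p')) ▷ B ≫ (nest _ _ _ _ _).hom)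
        ((nest _ _ _ _ _).inv ≫ (A ◁ (q' ≫ edge h' f)) ▷ B ≫ q) := by
  refine map_arc (tubeMul.flip (arc A' B' p' q')) (fun A B p q => arc (A ⊗ A') (B' ⊗ B)
    (p ≫ (A ◁ (edge e c' ≫ p')) ▷ B ≫ (nest _ _ _ _ _).hom)
    ((nest _ _ _ _ _).inv ≫ (A ◁ (q' ≫ edge h' f)) ▷ B ≫ q))
    (fun a b p q => ?_) (fun A B p q₁ q₂ => ?_) (fun {A₁ A₂ B₁ B₂} k l p q => ?_) p q
  · rw [← arc_simple]
    refine map_arc (tubeMul (arc a.obj b.obj p q)) (fun A' B' p' q' => arc (a.obj ⊗ A') (B' ⊗ b.obj)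
      (p ≫ (a.obj ◁ (edge e c' ≫ p')) ▷ b.obj ≫ (nest _ _ _ _ _).hom)
      ((nest _ _ _ _ _).inv ≫ (a.obj ◁ (q' ≫ edge h' f)) ▷ b.obj ≫ q))
      (fun a' b' p' q' => ?_) (fun A' B' p' q₁ q₂ => ?_) (fun {A₁ A₂ B₁ B₂} k l p' q' => ?_) p' q'
    · rw [← arc_simple, tubeMul_arc_simple]
    · simp [arc, TensorProduct.tmul_add]
    · refine (arc_congr (𝟙 a.obj ⊗ₘ k) (l ⊗ₘ 𝟙 b.obj) ?_ ?_).symm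
      · simp only [← id_tensorHom, ← tensorHom_id, tensorHom_comp_tensorHom,
          tensorHom_comp_tensorHom_assoc, Category.assoc, Category.comp_id, ← nest_naturality]
      · simp only [← id_tensorHom, ← tensorHom_id, tensorHom_comp_tensorHom,
          tensorHom_comp_tensorHom_assoc, Category.assoc, Category.comp_id,
          reassoc_of% nest_inv_naturality]
  · simp [arc, TensorProduct.tmul_add]
  · refine (arc_congr (k ⊗ₘ 𝟙 A') (𝟙 B' ⊗ₘ l) ?_ ?_).symm
    · simp only [← id_tensorHom, ← tensorHom_id, tensorHom_comp_tensorHom,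
        tensorHom_comp_tensorHom_assoc, Category.assoc, Category.id_comp, Category.comp_id,
        id_tensorHom_id, ← nest_naturality]
    · simp only [← id_tensorHom, ← tensorHom_id, tensorHom_comp_tensorHom,
        tensorHom_comp_tensorHom_assoc, Category.id_comp, Category.comp_id,
        id_tensorHom_id, reassoc_of% nest_inv_naturality]

end Mul

section Algebras

theorem sum_sum_eq_single {ι κ M : Type*} [Fintype ι] [Fintype κ] [AddCommMonoid M] (i : ι) (j : κ)
    {F : ι → κ → M} (hF : ∀ i' j', i' ≠ i ∨ j' ≠ j → F i' j' = 0) :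
    ∑ i', ∑ j', F i' j' = F i j := by
  rw [Fintype.sum_eq_single i fun i' hi => Finset.sum_eq_zero fun j' _ => hF _ _ (Or.inl hi)]
  exact Fintype.sum_eq_single j fun j' hj => hF _ _ (Or.inr hj)

theorem tubeOne_eq : tubeOne (C := C) = ∑ c : Irr C, ∑ h : Irr C,
    arc (𝟙_ C) (𝟙_ C) ((λ_ c.obj).inv ≫ (ρ_ (𝟙_ C ⊗ c.obj)).inv)
      ((ρ_ (𝟙_ C ⊗ h.obj)).hom ≫ (λ_ h.obj).hom) := rfl

theorem lOne_eq : lOne (C := C) = ∑ d : Irr C, ∑ g : Irr C,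
    lArc (𝟙_ C) (λ_ d.obj).inv (λ_ g.obj).hom := rfl

theorem rOne_eq : rOne (C := C) = ∑ c : Irr C, ∑ h : Irr C,
    rArc (𝟙_ C) (ρ_ c.obj).inv (ρ_ h.obj).hom := rfl

variable {A B : C} {c d e f g h : Irr C}

@[simp]
theorem lArc_zero_left (q : A ⊗ f.obj ⟶ g.obj) : lArc A (0 : d.obj ⟶ A ⊗ e.obj) q = 0 := by
  simp [lArc]

@[simp]
theorem lArc_zero_right (p : d.obj ⟶ A ⊗ e.obj) : lArc A p (0 : A ⊗ f.obj ⟶ g.obj) = 0 := by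
  simp [lArc]

@[simp]
theorem rArc_zero_left (q : f.obj ⊗ B ⟶ h.obj) : rArc B (0 : c.obj ⟶ e.obj ⊗ B) q = 0 := by
  simp [rArc]

@[simp]
theorem rArc_zero_right (p : c.obj ⟶ e.obj ⊗ B) : rArc B p (0 : f.obj ⊗ B ⟶ h.obj) = 0 := by
  simp [rArc]

@[simp]
theorem arc_zero_left (q : (A ⊗ f.obj) ⊗ B ⟶ h.obj) :
    arc A B (0 : c.obj ⟶ (A ⊗ e.obj) ⊗ B) q = 0 := by
  simp [arc]

@[simp]
theorem arc_zero_right (p : c.obj ⟶ (A ⊗ e.obj) ⊗ B) :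
    arc A B p (0 : (A ⊗ f.obj) ⊗ B ⟶ h.obj) = 0 := by
  simp [arc]

theorem lMul_assoc (x y z : LTube C) : lMul (lMul x y) z = lMul x (lMul y z) := by
  suffices lMul.compr₂ lMul = (LinearMap.llcomp ℂ _ _ _).compl₁₂ (lMul (C := C)) lMul from
    LinearMap.congr_fun (LinearMap.congr_fun₂ this x y) z
  refine LTube.hom_ext fun _ _ _ _ _ _ _ => LTube.hom_ext fun _ _ _ _ _ _ _ =>
    LTube.hom_ext fun _ _ _ _ _ _ _ => ?_
  simp only [LinearMap.compr₂_apply, LinearMap.compl₁₂_apply, LinearMap.llcomp_apply, lMul_lArc]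
  refine lArc_congr (α_ _ _ _).hom ?_ ?_ <;> monoidal

theorem lOne_mul (x : LTube C) : lMul lOne x = x := by
  suffices lMul (C := C) lOne = LinearMap.id from LinearMap.congr_fun this x
  refine LTube.hom_ext fun a d e f g p q => ?_
  simp only [lOne_eq, map_sum, LinearMap.sum_apply, lMul_lArc, LinearMap.id_apply]
  rw [sum_sum_eq_single d g]
  · simp only [edge_self]
    refine lArc_congr (λ_ _).hom ?_ ?_ <;> monoidal
  · rintro x y (hx | hy)
    · simp [edge_of_ne hx]
    · simp [edge_of_ne hy.symm]

theorem lMul_one (x : LTube C) : lMul x lOne = x := by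
  suffices (lMul (C := C)).flip lOne = LinearMap.id from LinearMap.congr_fun this x
  refine LTube.hom_ext fun a d e f g p q => ?_
  simp only [lOne_eq, map_sum, LinearMap.sum_apply, LinearMap.flip_apply, lMul_lArc,
    LinearMap.id_apply]
  rw [sum_sum_eq_single e f]
  · simp only [edge_self]
    refine lArc_congr (ρ_ _).hom ?_ ?_ <;> monoidal
  · rintro x y (hx | hy)
    · simp [edge_of_ne hx.symm]
    · simp [edge_of_ne hy]

theorem rMul_assoc (x y z : RTube C) : rMul (rMul x y) z = rMul x (rMul y z) := by
  suffices rMul.compr₂ rMul = (LinearMap.llcomp ℂ _ _ _).compl₁₂ (rMul (C := C)) rMul from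
    LinearMap.congr_fun (LinearMap.congr_fun₂ this x y) z
  refine RTube.hom_ext fun _ _ _ _ _ _ _ => RTube.hom_ext fun _ _ _ _ _ _ _ =>
    RTube.hom_ext fun _ _ _ _ _ _ _ => ?_
  simp only [LinearMap.compr₂_apply, LinearMap.compl₁₂_apply, LinearMap.llcomp_apply, rMul_rArc]
  refine rArc_congr (α_ _ _ _).inv ?_ ?_ <;> monoidal

theorem rOne_mul (x : RTube C) : rMul rOne x = x := by
  suffices rMul (C := C) rOne = LinearMap.id from LinearMap.congr_fun this x
  refine RTube.hom_ext fun b c e f h p q => ?_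
  simp only [rOne_eq, map_sum, LinearMap.sum_apply, rMul_rArc, LinearMap.id_apply]
  rw [sum_sum_eq_single c h]
  · simp only [edge_self]
    refine rArc_congr (ρ_ _).hom ?_ ?_ <;> monoidal
  · rintro x y (hx | hy)
    · simp [edge_of_ne hx]
    · simp [edge_of_ne hy.symm]

theorem rMul_one (x : RTube C) : rMul x rOne = x := by
  suffices (rMul (C := C)).flip rOne = LinearMap.id from LinearMap.congr_fun this x
  refine RTube.hom_ext fun b c e f h p q => ?_
  simp only [rOne_eq, map_sum, LinearMap.sum_apply, LinearMap.flip_apply, rMul_rArc,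
    LinearMap.id_apply]
  rw [sum_sum_eq_single e f]
  · simp only [edge_self]
    refine rArc_congr (λ_ _).hom ?_ ?_ <;> monoidal
  · rintro x y (hx | hy)
    · simp [edge_of_ne hx.symm]
    · simp [edge_of_ne hy]

theorem tubeMul_assoc (x y z : Tube C) : tubeMul (tubeMul x y) z = tubeMul x (tubeMul y z) := by
  suffices tubeMul.compr₂ tubeMul = (LinearMap.llcomp ℂ _ _ _).compl₁₂ (tubeMul (C := C)) tubeMul
    from LinearMap.congr_fun (LinearMap.congr_fun₂ this x y) z
  refine Tube.hom_ext fun _ _ _ _ _ _ _ _ => Tube.hom_ext fun _ _ _ _ _ _ _ _ =>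
    Tube.hom_ext fun _ _ _ _ _ _ _ _ => ?_
  simp only [LinearMap.compr₂_apply, LinearMap.compl₁₂_apply, LinearMap.llcomp_apply, tubeMul_arc]
  refine arc_congr (α_ _ _ _).hom (α_ _ _ _).inv ?_ ?_ <;>
    simp only [nest_hom, nest_inv, MonoidalCategory.tensorHom_def] <;>
    monoidal

theorem tubeOne_mul (x : Tube C) : tubeMul tubeOne x = x := by
  suffices tubeMul (C := C) tubeOne = LinearMap.id from LinearMap.congr_fun this x
  refine Tube.hom_ext fun a b c e f h p q => ?_
  simp only [tubeOne_eq, map_sum, LinearMap.sum_apply, tubeMul_arc, LinearMap.id_apply]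
  rw [sum_sum_eq_single c h]
  · simp only [edge_self]
    refine arc_congr (λ_ _).hom (ρ_ _).hom ?_ ?_ <;>
      simp only [nest_hom, nest_inv, MonoidalCategory.tensorHom_def] <;>
      monoidal
  · rintro x y (hx | hy)
    · simp [edge_of_ne hx]
    · simp [edge_of_ne hy.symm]

theorem tubeMul_one (x : Tube C) : tubeMul x tubeOne = x := by
  suffices (tubeMul (C := C)).flip tubeOne = LinearMap.id from LinearMap.congr_fun this x
  refine Tube.hom_ext fun a b c e f h p q => ?_
  simp only [tubeOne_eq, map_sum, LinearMap.sum_apply, LinearMap.flip_apply, tubeMul_arc,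
    LinearMap.id_apply]
  rw [sum_sum_eq_single e f]
  · simp only [edge_self]
    refine arc_congr (ρ_ _).hom (λ_ _).hom ?_ ?_ <;>
      simp only [nest_hom, nest_inv, MonoidalCategory.tensorHom_def] <;>
      monoidal
  · rintro x y (hx | hy)
    · simp [edge_of_ne hx.symm]
    · simp [edge_of_ne hy]

theorem isAlgebra_lTube : IsAlgebra (lMul (C := C)) lOne :=
  ⟨lMul_assoc, lOne_mul, lMul_one⟩

theorem isAlgebra_rTube : IsAlgebra (rMul (C := C)) rOne :=
  ⟨rMul_assoc, rOne_mul, rMul_one⟩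

theorem isAlgebra_tube : IsAlgebra (tubeMul (C := C)) tubeOne :=
  ⟨tubeMul_assoc, tubeOne_mul, tubeMul_one⟩

end Algebras

section Comul

variable {A A' B B' : C} {a b c d e f g h : Irr C}

theorem tubeComul_arc_simple (p : c.obj ⟶ (a.obj ⊗ e.obj) ⊗ b.obj)
    (q : (a.obj ⊗ f.obj) ⊗ b.obj ⟶ h.obj) :
    tubeComul (arc a.obj b.obj p q) =
      ∑ i : Irr C, ∑ m, arc a.obj b.obj ((decomp ((a.obj ⊗ i.obj) ⊗ b.obj)).incl m) q ⊗ₜ[ℂ]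
        arc a.obj b.obj p ((decomp ((a.obj ⊗ i.obj) ⊗ b.obj)).proj m) := by
  simp [arc_simple, tubeComul]

theorem lComul_lArc_simple (p : d.obj ⟶ a.obj ⊗ e.obj) (q : a.obj ⊗ f.obj ⟶ g.obj) :
    lComul (lArc a.obj p q) =
      ∑ i : Irr C, ∑ m, lArc a.obj ((decomp (a.obj ⊗ i.obj)).incl m) q ⊗ₜ[ℂ]
        lArc a.obj p ((decomp (a.obj ⊗ i.obj)).proj m) := by
  simp [lArc_simple, lComul]

theorem rComul_rArc_simple (p : c.obj ⟶ e.obj ⊗ b.obj) (q : f.obj ⊗ b.obj ⟶ h.obj) :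
    rComul (rArc b.obj p q) =
      ∑ i : Irr C, ∑ m, rArc b.obj ((decomp (i.obj ⊗ b.obj)).incl m) q ⊗ₜ[ℂ]
        rArc b.obj p ((decomp (i.obj ⊗ b.obj)).proj m) := by
  simp [rArc_simple, rComul]

theorem sum_arc_tmul_arc {Z Z' : C} (D : SimpleDecomp Z) (D' : SimpleDecomp Z') (k : Z ⟶ Z')
    {i j : Irr C} (l : Z' ⟶ (A ⊗ i.obj) ⊗ B) (m : (A' ⊗ j.obj) ⊗ B' ⟶ Z)
    (p : c.obj ⟶ (A' ⊗ e.obj) ⊗ B') (q : (A ⊗ f.obj) ⊗ B ⟶ h.obj) :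
    ∑ n, arc A B (D.incl n ≫ k ≫ l) q ⊗ₜ[ℂ] arc A' B' p (m ≫ D.proj n) =
      ∑ n, arc A B (D'.incl n ≫ l) q ⊗ₜ[ℂ] arc A' B' p (m ≫ k ≫ D'.proj n) := by
  have := SimpleDecomp.sum_comp D D' k
    (Ψ := fun x u w => arc A B (w ≫ l) q ⊗ₜ[ℂ] arc A' B' p (m ≫ u)) fun x => by
      constructor <;> simp [arc, TensorProduct.add_tmul, TensorProduct.tmul_add,
        TensorProduct.smul_tmul]
  simpa only [Category.assoc] using this

theorem tubeComul_arc (p : c.obj ⟶ (A ⊗ e.obj) ⊗ B) (q : (A ⊗ f.obj) ⊗ B ⟶ h.obj) :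
    tubeComul (arc A B p q) =
      ∑ i : Irr C, ∑ m, arc A B ((decomp ((A ⊗ i.obj) ⊗ B)).incl m) q ⊗ₜ[ℂ]
        arc A B p ((decomp ((A ⊗ i.obj) ⊗ B)).proj m) := by
  refine map_arc tubeComul (fun A B p q =>
    ∑ i : Irr C, ∑ m, arc A B ((decomp ((A ⊗ i.obj) ⊗ B)).incl m) q ⊗ₜ[ℂ]
      arc A B p ((decomp ((A ⊗ i.obj) ⊗ B)).proj m))
    (fun a b p q => ?_) (fun A B p q q' => ?_) (fun {A A' B B'} k l p q => ?_) p q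
  · rw [← arc_simple, tubeComul_arc_simple]
  · simp [arc, TensorProduct.tmul_add, TensorProduct.add_tmul, Finset.sum_add_distrib]
  · refine Finset.sum_congr rfl fun i _ => ?_
    have slide := sum_arc_tmul_arc (decomp ((A ⊗ i.obj) ⊗ B)) (decomp ((A' ⊗ i.obj) ⊗ B'))
      (k ▷ i.obj ⊗ₘ l) (𝟙 _) (𝟙 _) p q
    simpa only [Category.comp_id, Category.id_comp, arc_dinatural] using slide.symm

theorem tubeCounit_arc (p : c.obj ⟶ (A ⊗ e.obj) ⊗ B) (q : (A ⊗ f.obj) ⊗ B ⟶ h.obj) :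
    tubeCounit (arc A B p q) = scalar c (p ≫ (A ◁ edge e f) ▷ B ≫ q ≫ edge h c) := by
  refine map_arc tubeCounit (fun A B p q => scalar c (p ≫ (A ◁ edge e f) ▷ B ≫ q ≫ edge h c))
    (fun a b p q => by simp [tubeCounit]) (fun A B p q q' => by simp)
    (fun {A A' B B'} k l p q => ?_) p q
  simp only [← id_tensorHom, ← tensorHom_id, tensorHom_comp_tensorHom_assoc,
    tensorHom_comp_tensorHom, Category.assoc, Category.id_comp, Category.comp_id]

theorem lCounit_lArc_simple (p : d.obj ⟶ a.obj ⊗ e.obj) (q : a.obj ⊗ f.obj ⟶ g.obj) :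
    lCounit (lArc a.obj p q) = scalar d (p ≫ a.obj ◁ edge e f ≫ q ≫ edge g d) := by
  simp [lArc_simple, lCounit]

theorem rCounit_rArc_simple (p : c.obj ⟶ e.obj ⊗ b.obj) (q : f.obj ⊗ b.obj ⟶ h.obj) :
    rCounit (rArc b.obj p q) = scalar c (p ≫ edge e f ▷ b.obj ≫ q ≫ edge h c) := by
  simp [rArc_simple, rCounit]

end Comul

/-! ### The boundary tube algebras inside the bulk tube algebra -/

section ToTube

variable {A B : C} {c d e f g h : Irr C}

theorem lToTube_lArc (p : d.obj ⟶ A ⊗ e.obj) (q : A ⊗ f.obj ⟶ g.obj) :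
    lToTube (lArc A p q) = arc A (𝟙_ C) (p ≫ (ρ_ _).inv) ((ρ_ _).hom ≫ q) := by
  refine map_lArc lToTube (fun A p q => arc A (𝟙_ C) (p ≫ (ρ_ _).inv) ((ρ_ _).hom ≫ q))
    (fun a p q => by simp [lToTube, arc]) (fun A p q q' => by simp [arc, TensorProduct.tmul_add])
    (fun {A A'} k p q => ?_) p q
  exact (arc_congr k (𝟙 _) (by simp) (by simp)).symm

theorem rToTube_rArc (p : c.obj ⟶ e.obj ⊗ B) (q : f.obj ⊗ B ⟶ h.obj) :
    rToTube (rArc B p q) = arc (𝟙_ C) B (p ≫ (λ_ _).inv ▷ B) ((λ_ _).hom ▷ B ≫ q) := by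
  refine map_rArc rToTube (fun B p q => arc (𝟙_ C) B (p ≫ (λ_ _).inv ▷ B) ((λ_ _).hom ▷ B ≫ q))
    (fun b p q => by simp [rToTube, arc]) (fun B p q q' => by simp [arc, TensorProduct.tmul_add])
    (fun {B B'} k p q => ?_) p q
  exact (arc_congr (𝟙 _) k (by simp) (by simp)).symm

theorem lToTube_lMul (x y : LTube C) :
    lToTube (lMul x y) = tubeMul (lToTube x) (lToTube y) := by
  suffices (lMul (C := C)).compr₂ lToTube = tubeMul.compl₁₂ lToTube lToTube from
    LinearMap.congr_fun₂ this x y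
  refine LTube.hom_ext fun _ _ _ _ _ _ _ => LTube.hom_ext fun _ _ _ _ _ _ _ => ?_
  simp only [LinearMap.compr₂_apply, LinearMap.compl₁₂_apply, lMul_lArc, lToTube_lArc, tubeMul_arc]
  refine arc_congr (𝟙 _) (λ_ _).inv ?_ ?_ <;>
    simp only [nest_hom, nest_inv, MonoidalCategory.tensorHom_def] <;>
    monoidal

theorem rToTube_rMul (x y : RTube C) :
    rToTube (rMul x y) = tubeMul (rToTube x) (rToTube y) := by
  suffices (rMul (C := C)).compr₂ rToTube = tubeMul.compl₁₂ rToTube rToTube from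
    LinearMap.congr_fun₂ this x y
  refine RTube.hom_ext fun _ _ _ _ _ _ _ => RTube.hom_ext fun _ _ _ _ _ _ _ => ?_
  simp only [LinearMap.compr₂_apply, LinearMap.compl₁₂_apply, rMul_rArc, rToTube_rArc, tubeMul_arc]
  refine arc_congr (λ_ _).inv (𝟙 _) ?_ ?_ <;>
    simp only [nest_hom, nest_inv, MonoidalCategory.tensorHom_def] <;>
    monoidal

theorem lToTube_lOne : lToTube (C := C) lOne = tubeOne := by
  simp only [lOne_eq, tubeOne_eq, map_sum, lToTube_lArc]

theorem rToTube_rOne : rToTube (C := C) rOne = tubeOne := by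
  simp only [rOne_eq, tubeOne_eq, map_sum, rToTube_rArc]
  refine Finset.sum_congr rfl fun c _ => Finset.sum_congr rfl fun h _ => ?_
  refine arc_congr (𝟙 _) (𝟙 _) ?_ ?_ <;> simp

theorem tubeComul_lToTube (x : LTube C) :
    tubeComul (lToTube x) = TensorProduct.map lToTube lToTube (lComul x) := by
  suffices tubeComul ∘ₗ lToTube (C := C) = TensorProduct.map lToTube lToTube ∘ₗ lComul from
    LinearMap.congr_fun this x
  refine LTube.hom_ext (V := Tube C ⊗[ℂ] Tube C) fun a d e f g p q => ?_
  simp only [LinearMap.comp_apply, lComul_lArc_simple, lToTube_lArc, map_sum,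
    TensorProduct.map_tmul, tubeComul_arc]
  refine Finset.sum_congr rfl fun i _ => ?_
  have := sum_arc_tmul_arc (decomp (a.obj ⊗ i.obj)) (decomp ((a.obj ⊗ i.obj) ⊗ 𝟙_ C))
    (ρ_ _).inv (𝟙 _) (ρ_ _).hom (p ≫ (ρ_ _).inv) ((ρ_ _).hom ≫ q)
  simpa using this.symm

theorem tubeComul_rToTube (x : RTube C) :
    tubeComul (rToTube x) = TensorProduct.map rToTube rToTube (rComul x) := by
  suffices tubeComul ∘ₗ rToTube (C := C) = TensorProduct.map rToTube rToTube ∘ₗ rComul from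
    LinearMap.congr_fun this x
  refine RTube.hom_ext (V := Tube C ⊗[ℂ] Tube C) fun b c e f h p q => ?_
  simp only [LinearMap.comp_apply, rComul_rArc_simple, rToTube_rArc, map_sum,
    TensorProduct.map_tmul, tubeComul_arc]
  refine Finset.sum_congr rfl fun i _ => ?_
  have := sum_arc_tmul_arc (decomp (i.obj ⊗ b.obj)) (decomp ((𝟙_ C ⊗ i.obj) ⊗ b.obj))
    ((λ_ _).inv ▷ _) (𝟙 _) ((λ_ _).hom ▷ _) (p ≫ (λ_ _).inv ▷ _) ((λ_ _).hom ▷ _ ≫ q)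
  simpa using this.symm

theorem tubeCounit_lToTube (x : LTube C) : tubeCounit (lToTube x) = lCounit x := by
  suffices tubeCounit ∘ₗ lToTube (C := C) = lCounit from LinearMap.congr_fun this x
  refine LTube.hom_ext fun a d e f g p q => ?_
  simp [lToTube_lArc, lCounit_lArc_simple, tubeCounit_arc]

theorem tubeCounit_rToTube (x : RTube C) : tubeCounit (rToTube x) = rCounit x := by
  suffices tubeCounit ∘ₗ rToTube (C := C) = rCounit from LinearMap.congr_fun this x
  refine RTube.hom_ext fun b c e f h p q => ?_
  simp [rToTube_rArc, rCounit_rArc_simple, tubeCounit_arc]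

end ToTube

/-! ### Gluing right to left boundary diagrams -/

section Glue

variable {A B : C} {a b c d e f g h c' d' e' f' g' h' : Irr C}

/-- Gluing of right to left boundary diagrams: multiplication inside the bulk tube algebra. -/
def glue : RTube C ⊗[ℂ] LTube C →ₗ[ℂ] Tube C :=
  TensorProduct.lift (tubeMul.compl₁₂ rToTube lToTube)

theorem glue_tmul (r : RTube C) (l : LTube C) :
    glue (r ⊗ₜ[ℂ] l) = tubeMul (rToTube r) (lToTube l) := rfl

theorem glue_arc (μ : c.obj ⟶ d.obj ⊗ B) (γ : g.obj ⊗ B ⟶ h.obj) (ν : d'.obj ⟶ A ⊗ e.obj)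
    (ζ : A ⊗ f.obj ⟶ g'.obj) :
    glue (rArc B μ γ ⊗ₜ[ℂ] lArc A ν ζ) =
      arc A B (μ ≫ (edge d d' ≫ ν) ▷ B) ((ζ ≫ edge g' g) ▷ B ≫ γ) := by
  rw [glue_tmul, rToTube_rArc, lToTube_lArc, tubeMul_arc]
  refine arc_congr (λ_ _).hom (λ_ _).hom ?_ ?_ <;>
    simp only [nest_hom, nest_inv, MonoidalCategory.tensorHom_def] <;>
    monoidal

theorem tubeMul_lToTube_rToTube (p : d.obj ⟶ A ⊗ e.obj) (q : A ⊗ f.obj ⟶ g.obj)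
    (p' : c'.obj ⟶ e'.obj ⊗ B) (q' : f'.obj ⊗ B ⟶ h'.obj) :
    tubeMul (lToTube (lArc A p q)) (rToTube (rArc B p' q')) =
      arc A B (p ≫ A ◁ (edge e c' ≫ p') ≫ (α_ _ _ _).inv)
        ((α_ _ _ _).hom ≫ A ◁ (q' ≫ edge h' f) ≫ q) := by
  rw [rToTube_rArc, lToTube_lArc, tubeMul_arc]
  refine arc_congr (ρ_ _).hom (ρ_ _).hom ?_ ?_ <;>
    simp only [nest_hom, nest_inv, MonoidalCategory.tensorHom_def] <;>
    monoidal

theorem arc_sum_left {ι : Type*} (s : Finset ι) (p : ι → (c.obj ⟶ (A ⊗ e.obj) ⊗ B))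
    (q : (A ⊗ f.obj) ⊗ B ⟶ h.obj) : arc A B (∑ i ∈ s, p i) q = ∑ i ∈ s, arc A B (p i) q := by
  simp [arc, TensorProduct.sum_tmul]

theorem arc_sum_right {ι : Type*} (s : Finset ι) (p : c.obj ⟶ (A ⊗ e.obj) ⊗ B)
    (q : ι → ((A ⊗ f.obj) ⊗ B ⟶ h.obj)) :
    arc A B p (∑ i ∈ s, q i) = ∑ i ∈ s, arc A B p (q i) := by
  simp [arc, TensorProduct.tmul_sum]

theorem cut_tmul (p : d.obj ⟶ (a.obj ⊗ e.obj) ⊗ b.obj) (q : (a.obj ⊗ f.obj) ⊗ b.obj ⟶ g.obj) :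
    cut a b d e f g (p ⊗ₜ[ℂ] q) = ∑ m, ∑ n,
      rArc b.obj (p ≫ (decomp (a.obj ⊗ e.obj)).proj m ▷ b.obj)
          ((decomp (a.obj ⊗ f.obj)).incl n ▷ b.obj ≫ q) ⊗ₜ[ℂ]
        lArc a.obj ((decomp (a.obj ⊗ e.obj)).incl m) ((decomp (a.obj ⊗ f.obj)).proj n) := by
  simp [cut, rArc_simple, lArc_simple, lDiagram]

theorem glue_cut (p : d.obj ⟶ (a.obj ⊗ e.obj) ⊗ b.obj)
    (q : (a.obj ⊗ f.obj) ⊗ b.obj ⟶ g.obj) :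
    glue (cut a b d e f g (p ⊗ₜ[ℂ] q)) = arc a.obj b.obj p q := by
  simp only [cut_tmul, map_sum, glue_arc, edge_self, Category.id_comp, Category.comp_id,
    Category.assoc, ← comp_whiskerRight, ← comp_whiskerRight_assoc]
  simp only [← arc_sum_left, ← arc_sum_right, ← sum_whiskerRight, ← Preadditive.sum_comp,
    ← Preadditive.comp_sum, SimpleDecomp.total, id_whiskerRight, Category.id_comp,
    Category.comp_id]

theorem exchange_arc (p : d.obj ⟶ a.obj ⊗ e.obj) (q : a.obj ⊗ f.obj ⟶ g.obj)
    (p' : c'.obj ⟶ e'.obj ⊗ b.obj) (q' : f'.obj ⊗ b.obj ⟶ h'.obj) :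
    exchange (lArc a.obj p q) (rArc b.obj p' q') = cut a b d e' f' g
      ((p ≫ a.obj ◁ (edge e c' ≫ p') ≫ (α_ _ _ _).inv) ⊗ₜ[ℂ]
        ((α_ _ _ _).hom ≫ a.obj ◁ (q' ≫ edge h' f) ≫ q)) := by
  simp [lArc_simple, rArc_simple, exchange, exLow, exUp]

theorem glue_exchange (l : LTube C) (r : RTube C) :
    glue (exchange l r) = tubeMul (lToTube l) (rToTube r) := by
  suffices (exchange (C := C)).compr₂ glue = tubeMul.compl₁₂ lToTube rToTube from
    LinearMap.congr_fun₂ this l r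
  refine LTube.hom_ext fun _ _ _ _ _ _ _ => RTube.hom_ext fun _ _ _ _ _ _ _ => ?_
  simp only [LinearMap.compr₂_apply, LinearMap.compl₁₂_apply, exchange_arc, glue_cut,
    tubeMul_lToTube_rToTube]

theorem glue_map_mul (r : RTube C) (l : LTube C) (z : RTube C ⊗[ℂ] LTube C) :
    glue (TensorProduct.map (rMul r) (lMul.flip l) z) =
      tubeMul (tubeMul (rToTube r) (glue z)) (lToTube l) := by
  induction z using TensorProduct.induction_on with
  | zero => simp
  | add x y hx hy => simp only [map_add, LinearMap.add_apply, hx, hy]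
  | tmul r' l' =>
    simp only [TensorProduct.map_tmul, glue_tmul, LinearMap.flip_apply, rToTube_rMul,
      lToTube_lMul, tubeMul_assoc]

theorem glue_preMul (z w : RTube C ⊗[ℂ] LTube C) :
    glue (preMul z w) = tubeMul (glue z) (glue w) := by
  suffices (preMul (C := C)).compr₂ glue = tubeMul.compl₁₂ glue glue from
    LinearMap.congr_fun₂ this z w
  refine TensorProduct.ext' fun r l => TensorProduct.ext' fun r' l' => ?_
  calc glue (preMul (r ⊗ₜ[ℂ] l) (r' ⊗ₜ[ℂ] l'))
      = tubeMul (tubeMul (rToTube r) (tubeMul (lToTube l) (rToTube r'))) (lToTube l') := by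
        rw [preMul_tmul, glue_map_mul, glue_exchange]
    _ = tubeMul (tubeMul (rToTube r) (lToTube l)) (tubeMul (rToTube r') (lToTube l')) := by
        simp only [tubeMul_assoc]

theorem cross_eq_zero (hne : d ≠ d' ∨ g ≠ g') (μ : c.obj ⟶ d.obj ⊗ b.obj)
    (γ : g.obj ⊗ b.obj ⟶ h.obj) (ν : d'.obj ⟶ a.obj ⊗ e.obj) (ζ : a.obj ⊗ f.obj ⟶ g'.obj) :
    cross (rArc b.obj μ γ) (lArc a.obj ν ζ) = 0 := by
  rw [rArc_simple, lArc_simple]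
  exact mkQ_of_ne hne _ _

theorem glue_eq_zero (hne : d ≠ d' ∨ g ≠ g') (μ : c.obj ⟶ d.obj ⊗ B)
    (γ : g.obj ⊗ B ⟶ h.obj) (ν : d'.obj ⟶ A ⊗ e.obj) (ζ : A ⊗ f.obj ⟶ g'.obj) :
    glue (rArc B μ γ ⊗ₜ[ℂ] lArc A ν ζ) = 0 := by
  rw [glue_arc]
  rcases hne with hne | hne
  · simp [edge_of_ne hne]
  · simp [edge_of_ne hne.symm]

theorem gluingRelations_le_ker_glue : gluingRelations C ≤ LinearMap.ker (glue (C := C)) := by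
  refine Submodule.span_le.2 ?_
  rintro _ ⟨t, s, x, y, hne, rfl⟩
  suffices (tubeMul.compl₁₂ rToTube lToTube).compl₁₂ (rOf t) (lOf s) = 0 from
    LinearMap.congr_fun₂ this x y
  refine TensorProduct.ext' fun μ γ => TensorProduct.ext' fun ν ζ => ?_
  have glued := glue_eq_zero hne μ γ ν ζ
  rw [rArc_simple, lArc_simple] at glued
  exact glued

/-- Gluing, as a map from the crossed product. -/
def crossGlue : CrossedProduct C →ₗ[ℂ] Tube C :=
  (gluingRelations C).liftQ glue gluingRelations_le_ker_glue

/-- Cutting of bulk diagrams into right and left boundary diagrams, the inverse of gluing. -/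
def crossCut : Tube C →ₗ[ℂ] CrossedProduct C :=
  DirectSum.toModule ℂ (TubeLabel C) _ fun t =>
    (gluingRelations C).mkQ ∘ₗ cut t.a t.b t.c t.e t.f t.h

theorem crossGlue_mkQ (z : RTube C ⊗[ℂ] LTube C) :
    crossGlue ((gluingRelations C).mkQ z) = glue z := rfl

theorem crossGlue_cross_arc (μ : c.obj ⟶ d.obj ⊗ B) (γ : g.obj ⊗ B ⟶ h.obj)
    (ν : d'.obj ⟶ A ⊗ e.obj) (ζ : A ⊗ f.obj ⟶ g'.obj) :
    crossGlue (cross (rArc B μ γ) (lArc A ν ζ)) =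
      arc A B (μ ≫ (edge d d' ≫ ν) ▷ B) ((ζ ≫ edge g' g) ▷ B ≫ γ) :=
  glue_arc μ γ ν ζ

theorem crossCut_arc (p : c.obj ⟶ (a.obj ⊗ e.obj) ⊗ b.obj)
    (q : (a.obj ⊗ f.obj) ⊗ b.obj ⟶ h.obj) :
    crossCut (arc a.obj b.obj p q) =
      (gluingRelations C).mkQ (cut a b c e f h (p ⊗ₜ[ℂ] q)) := by
  simp [arc_simple, crossCut]

theorem crossGlue_comp_crossCut : crossGlue ∘ₗ crossCut (C := C) = LinearMap.id :=
  Tube.hom_ext fun a b c e f h p q => by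
    rw [LinearMap.comp_apply, crossCut_arc, crossGlue_mkQ, glue_cut, LinearMap.id_apply]

theorem sum_rArc_tmul_lArc_lower (D : SimpleDecomp (A ⊗ e.obj)) (μ : c.obj ⟶ d.obj ⊗ B)
    (γ : g.obj ⊗ B ⟶ h.obj) (ν : d.obj ⟶ A ⊗ e.obj) (ζ : A ⊗ f.obj ⟶ g'.obj) :
    ∑ m, rArc B (μ ≫ (ν ≫ D.proj m) ▷ B) γ ⊗ₜ[ℂ] lArc A (D.incl m) ζ =
      rArc B μ γ ⊗ₜ[ℂ] lArc A ν ζ := by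
  have := SimpleDecomp.sum_comp_proj D ν
    (Ψ := fun y u w => rArc B (μ ≫ u ▷ B) γ ⊗ₜ[ℂ] lArc A w ζ) fun y => by
      constructor <;> simp [rArc, lArc, TensorProduct.add_tmul, TensorProduct.tmul_add,
        TensorProduct.smul_tmul]
  simpa only [id_whiskerRight, Category.comp_id] using this

theorem sum_rArc_tmul_lArc_upper (U : SimpleDecomp (A ⊗ f.obj)) (μ : c.obj ⟶ d.obj ⊗ B)
    (γ : g.obj ⊗ B ⟶ h.obj) (ν : d'.obj ⟶ A ⊗ e.obj) (ζ : A ⊗ f.obj ⟶ g.obj) :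
    ∑ n, rArc B μ ((U.incl n ≫ ζ) ▷ B ≫ γ) ⊗ₜ[ℂ] lArc A ν (U.proj n) =
      rArc B μ γ ⊗ₜ[ℂ] lArc A ν ζ := by
  have := SimpleDecomp.sum_incl_comp U ζ
    (Ψ := fun y u w => rArc B μ (w ▷ B ≫ γ) ⊗ₜ[ℂ] lArc A ν u) fun y => by
      constructor <;> simp [rArc, lArc, TensorProduct.add_tmul, TensorProduct.tmul_add,
        TensorProduct.smul_tmul]
  simpa only [id_whiskerRight, Category.id_comp] using this

theorem cut_glued (μ : c.obj ⟶ d.obj ⊗ b.obj) (γ : g.obj ⊗ b.obj ⟶ h.obj)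
    (ν : d.obj ⟶ a.obj ⊗ e.obj) (ζ : a.obj ⊗ f.obj ⟶ g.obj) :
    cut a b c e f h ((μ ≫ ν ▷ b.obj) ⊗ₜ[ℂ] (ζ ▷ b.obj ≫ γ)) =
      rArc b.obj μ γ ⊗ₜ[ℂ] lArc a.obj ν ζ := by
  rw [cut_tmul, Finset.sum_comm]
  simp only [Category.assoc, ← comp_whiskerRight, ← comp_whiskerRight_assoc,
    sum_rArc_tmul_lArc_lower, sum_rArc_tmul_lArc_upper]

theorem CrossedProduct.hom_ext {φ ψ : CrossedProduct C →ₗ[ℂ] V}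
    (H : ∀ (a b c d d' e f g g' h : Irr C) (μ : c.obj ⟶ d.obj ⊗ b.obj)
      (γ : g.obj ⊗ b.obj ⟶ h.obj) (ν : d'.obj ⟶ a.obj ⊗ e.obj) (ζ : a.obj ⊗ f.obj ⟶ g'.obj),
      φ (cross (rArc b.obj μ γ) (lArc a.obj ν ζ)) = ψ (cross (rArc b.obj μ γ) (lArc a.obj ν ζ))) :
    φ = ψ :=
  Submodule.linearMap_qext _ <| TensorProduct.ext <| RTube.hom_ext fun b c d g h μ γ =>
    LTube.hom_ext fun a d' e f g' ν ζ => H a b c d d' e f g g' h μ γ ν ζ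

theorem crossCut_comp_crossGlue : crossCut ∘ₗ crossGlue (C := C) = LinearMap.id := by
  refine CrossedProduct.hom_ext fun a b c d d' e f g g' h μ γ ν ζ => ?_
  rw [LinearMap.comp_apply, LinearMap.id_apply]
  by_cases hne : d ≠ d' ∨ g ≠ g'
  · rw [cross_eq_zero hne, map_zero, map_zero]
  · push Not at hne
    obtain ⟨rfl, rfl⟩ := hne
    rw [crossGlue_cross_arc, crossCut_arc, edge_self, edge_self, Category.id_comp,
      Category.comp_id, cut_glued]
    rfl

/-- The isomorphism between the crossed product and the bulk tube algebra given by gluing. -/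
def crossEquiv : CrossedProduct C ≃ₗ[ℂ] Tube C :=
  LinearEquiv.ofLinearMap crossGlue crossCut crossGlue_comp_crossCut crossCut_comp_crossGlue

theorem crossEquiv_cross (r : RTube C) (l : LTube C) :
    crossEquiv (cross r l) = tubeMul (rToTube r) (lToTube l) := rfl

theorem crossEquiv_cross_arc (μ : c.obj ⟶ d.obj ⊗ B) (γ : g.obj ⊗ B ⟶ h.obj)
    (ν : d'.obj ⟶ A ⊗ e.obj) (ζ : A ⊗ f.obj ⟶ g'.obj) :
    crossEquiv (cross (rArc B μ γ) (lArc A ν ζ)) =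
      arc A B (μ ≫ (edge d d' ≫ ν) ▷ B) ((ζ ≫ edge g' g) ▷ B ≫ γ) :=
  glue_arc μ γ ν ζ

theorem crossEquiv_crossMul (x y : CrossedProduct C) :
    crossEquiv (crossMul x y) = tubeMul (crossEquiv x) (crossEquiv y) := by
  obtain ⟨x, rfl⟩ := (gluingRelations C).mkQ_surjective x
  obtain ⟨y, rfl⟩ := (gluingRelations C).mkQ_surjective y
  exact glue_preMul x y

theorem crossEquiv_crossOne : crossEquiv (C := C) crossOne = tubeOne := by
  rw [crossOne, crossEquiv_cross, rToTube_rOne, lToTube_lOne, tubeOne_mul]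

end Glue

section CrossedProduct

theorem IsAlgebra.of_injective {M N : Type*} [AddCommGroup M] [Module ℂ M] [AddCommGroup N]
    [Module ℂ N] {mul : M →ₗ[ℂ] M →ₗ[ℂ] M} {one : M} {mul' : N →ₗ[ℂ] N →ₗ[ℂ] N} {one' : N}
    (hN : IsAlgebra mul' one') {f : M → N} (hf : Function.Injective f)
    (map_mul : ∀ x y, f (mul x y) = mul' (f x) (f y)) (map_one : f one = one') :
    IsAlgebra mul one where
  assoc x y z := hf (by simp only [map_mul, hN.assoc])
  one_mul x := hf (by rw [map_mul, map_one, hN.one_mul])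
  mul_one x := hf (by rw [map_mul, map_one, hN.mul_one])

theorem isAlgebra_crossedProduct : IsAlgebra (crossMul (C := C)) crossOne :=
  isAlgebra_tube.of_injective crossEquiv.injective crossEquiv_crossMul crossEquiv_crossOne

variable {A B : C} {a b c d e f g h d' g' : Irr C}

theorem crossComul_cross_arc (μ : c.obj ⟶ d.obj ⊗ b.obj) (γ : g.obj ⊗ b.obj ⟶ h.obj)
    (ν : d'.obj ⟶ a.obj ⊗ e.obj) (ζ : a.obj ⊗ f.obj ⟶ g'.obj) :
    crossComul (cross (rArc b.obj μ γ) (lArc a.obj ν ζ)) = ∑ i : Irr C, ∑ n, ∑ j : Irr C, ∑ m,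
      cross (rArc b.obj ((decomp (j.obj ⊗ b.obj)).incl m) γ)
          (lArc a.obj ((decomp (a.obj ⊗ i.obj)).incl n) ζ) ⊗ₜ[ℂ]
        cross (rArc b.obj μ ((decomp (j.obj ⊗ b.obj)).proj m))
          (lArc a.obj ν ((decomp (a.obj ⊗ i.obj)).proj n)) := by
  change preComul (rArc b.obj μ γ ⊗ₜ[ℂ] lArc a.obj ν ζ) = _
  simp only [preComul, LinearMap.comp_apply, TensorProduct.map_tmul, rComul_rArc_simple,
    lComul_lArc_simple, TensorProduct.tmul_sum, TensorProduct.sum_tmul, map_sum,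
    LinearEquiv.coe_coe, TensorProduct.tensorTensorTensorComm_tmul]
  rfl

theorem sum_sum_arc_tmul_arc_edge {i x : Irr C}
    (E : SimpleDecomp ((A ⊗ i.obj) ⊗ B)) (k : x.obj ⟶ A ⊗ i.obj) (l : A ⊗ i.obj ⟶ x.obj)
    (p : c.obj ⟶ (A ⊗ e.obj) ⊗ B) (q : (A ⊗ f.obj) ⊗ B ⟶ h.obj) :
    ∑ y : Irr C, ∑ m,
        arc A B ((decomp (y.obj ⊗ B)).incl m ≫ (edge y x ≫ k) ▷ B) q ⊗ₜ[ℂ]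
          arc A B p ((l ≫ edge x y) ▷ B ≫ (decomp (y.obj ⊗ B)).proj m) =
      ∑ m, arc A B (E.incl m) q ⊗ₜ[ℂ] arc A B p ((l ≫ k) ▷ B ≫ E.proj m) := by
  rw [Fintype.sum_eq_single x fun y hy => by simp [edge_of_ne hy]]
  simpa using sum_arc_tmul_arc (decomp (x.obj ⊗ B)) E (k ▷ B) (𝟙 _) (l ▷ B) p q

theorem tubeComul_crossEquiv (x : CrossedProduct C) :
    tubeComul (crossEquiv x) =
      TensorProduct.map crossEquiv.toLinearMap crossEquiv.toLinearMap (crossComul x) := by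
  suffices tubeComul ∘ₗ (crossEquiv (C := C)).toLinearMap =
      TensorProduct.map crossEquiv.toLinearMap crossEquiv.toLinearMap ∘ₗ crossComul from
    LinearMap.congr_fun this x
  refine CrossedProduct.hom_ext (V := Tube C ⊗[ℂ] Tube C)
    fun a b c d d' e f g g' h μ γ ν ζ => ?_
  simp only [LinearMap.comp_apply, LinearEquiv.coe_coe, crossComul_cross_arc,
    crossEquiv_cross_arc, tubeComul_arc, map_sum, TensorProduct.map_tmul]
  refine Finset.sum_congr rfl fun i _ => ?_
  rw [Finset.sum_congr rfl fun n _ => sum_sum_arc_tmul_arc_edge (decomp ((a.obj ⊗ i.obj) ⊗ b.obj))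
    ((decomp (a.obj ⊗ i.obj)).incl n) ((decomp (a.obj ⊗ i.obj)).proj n) _ _, Finset.sum_comm]
  refine Finset.sum_congr rfl fun m _ => ?_
  simp only [← TensorProduct.tmul_sum, ← arc_sum_right, ← Preadditive.sum_comp,
    ← sum_whiskerRight, SimpleDecomp.total, id_whiskerRight, Category.id_comp]

end CrossedProduct

/-! ### The tensor unit and the canonical grading -/

section UnitAction

variable {M : Type*} [Category M] [MonoidalCategory M] {W X Y Z : M}

/-- The right action of an endomorphism of the tensor unit on the object `X`. -/
def rightAct (s : 𝟙_ M ⟶ 𝟙_ M) (X : M) : X ⟶ X := (ρ_ X).inv ≫ X ◁ s ≫ (ρ_ X).hom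

/-- The left action of an endomorphism of the tensor unit on the object `X`. -/
def leftAct (s : 𝟙_ M ⟶ 𝟙_ M) (X : M) : X ⟶ X := (λ_ X).inv ≫ s ▷ X ≫ (λ_ X).hom

theorem rightAct_comp (s t : 𝟙_ M ⟶ 𝟙_ M) (X : M) :
    rightAct (s ≫ t) X = rightAct s X ≫ rightAct t X := by
  simp [rightAct]

theorem leftAct_comp (s t : 𝟙_ M ⟶ 𝟙_ M) (X : M) :
    leftAct (s ≫ t) X = leftAct s X ≫ leftAct t X := by
  simp [leftAct]

theorem comp_rightAct (s : 𝟙_ M ⟶ 𝟙_ M) (f : X ⟶ Y) : f ≫ rightAct s Y = rightAct s X ≫ f := by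
  simp only [rightAct, rightUnitor_inv_naturality_assoc, ← whisker_exchange_assoc,
    rightUnitor_naturality, Category.assoc]

theorem rightAct_unit (s : 𝟙_ M ⟶ 𝟙_ M) : rightAct s (𝟙_ M) = s := by
  simp [rightAct, ← unitors_equal, ← unitors_inv_equal]

theorem unit_comp_comm (s t : 𝟙_ M ⟶ 𝟙_ M) : s ≫ t = t ≫ s := by
  simpa only [rightAct_unit] using comp_rightAct t s

theorem rightUnitor_inv_whisker_comp_rightUnitor_hom (s : 𝟙_ M ⟶ X) (t : X ⟶ 𝟙_ M) (k : W ⟶ Y) :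
    ((ρ_ W).inv ≫ W ◁ s ≫ k ▷ X) ≫ Y ◁ t ≫ (ρ_ Y).hom = rightAct (s ≫ t) W ≫ k := by
  simp [rightAct, ← whisker_exchange_assoc]

theorem rightUnitor_inv_comp_whisker_rightUnitor_hom (s : X ⟶ 𝟙_ M) (t : 𝟙_ M ⟶ X) (k : Y ⟶ W) :
    ((ρ_ Y).inv ≫ Y ◁ t) ≫ k ▷ X ≫ W ◁ s ≫ (ρ_ W).hom = k ≫ rightAct (t ≫ s) W := by
  simp [rightAct, whisker_exchange_assoc]

theorem leftUnitor_inv_whisker_comp_leftUnitor_hom (s : 𝟙_ M ⟶ X) (t : X ⟶ 𝟙_ M) (k : W ⟶ Y ⊗ Z) :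
    ((λ_ W).inv ≫ s ▷ W ≫ X ◁ k ≫ (α_ X Y Z).inv) ≫ (t ▷ Y ≫ (λ_ Y).hom) ▷ Z =
      leftAct (s ≫ t) W ≫ k := by
  have absorb : (α_ X Y Z).inv ≫ (t ▷ Y ≫ (λ_ Y).hom) ▷ Z = t ▷ (Y ⊗ Z) ≫ (λ_ (Y ⊗ Z)).hom := by
    simp
  rw [Category.assoc, Category.assoc, Category.assoc, absorb, whisker_exchange_assoc]
  simp [leftAct]

theorem leftUnitor_inv_comp_whisker_leftUnitor_hom (s : X ⟶ 𝟙_ M) (t : 𝟙_ M ⟶ X) (k : Y ⊗ Z ⟶ W) :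
    ((λ_ Y).inv ≫ t ▷ Y) ▷ Z ≫ (α_ X Y Z).hom ≫ X ◁ k ≫ s ▷ W ≫ (λ_ W).hom =
      k ≫ leftAct (t ≫ s) W := by
  have absorb : ((λ_ Y).inv ≫ t ▷ Y) ▷ Z ≫ (α_ X Y Z).hom = (λ_ (Y ⊗ Z)).inv ≫ t ▷ (Y ⊗ Z) := by
    simp
  rw [reassoc_of% absorb, ← whisker_exchange_assoc]
  simp [leftAct]

end UnitAction

section UnitSummand

variable {M : Type u} [Category.{v} M] [Abelian M] [MonoidalCategory M]

/-- The idempotent endomorphism of the tensor unit onto its `k`-th simple summand. -/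
def SimpleDecomp.idem (D : SimpleDecomp (𝟙_ M)) (k : Fin D.n) : 𝟙_ M ⟶ 𝟙_ M := D.proj k ≫ D.incl k

variable (D : SimpleDecomp (𝟙_ M)) {j k : Fin D.n}

theorem SimpleDecomp.idem_comp_self (k : Fin D.n) : D.idem k ≫ D.idem k = D.idem k := by
  rw [idem, Category.assoc, reassoc_of% D.incl_proj_self k]

theorem SimpleDecomp.idem_comp_of_ne (h : j ≠ k) : D.idem j ≫ D.idem k = 0 := by
  rw [idem, idem, Category.assoc, reassoc_of% D.incl_proj_ne j k h, zero_comp, comp_zero]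

-- An isomorphism of two distinct summands gives an endomorphism `f` of `𝟙` with
-- `idem j ≫ f = f` and `f ≫ idem j = 0`, whereas endomorphisms of `𝟙` commute.
theorem SimpleDecomp.edge_label_of_ne (h : j ≠ k) : edge (D.label j) (D.label k) = 0 := by
  let f : 𝟙_ M ⟶ 𝟙_ M := D.proj j ≫ edge (D.label j) (D.label k) ≫ D.incl k
  calc edge (D.label j) (D.label k)
      = D.incl j ≫ (D.idem j ≫ f) ≫ D.proj k := by
        simp [f, idem, D.incl_proj_self, reassoc_of% D.incl_proj_self]
    _ = D.incl j ≫ (f ≫ D.idem j) ≫ D.proj k := by rw [unit_comp_comm]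
    _ = 0 := by simp [idem, D.incl_proj_ne j k h]

theorem isUnitLabel_label (j : Fin D.n) : IsUnitLabel (D.label j) := by
  refine ⟨D.proj j, fun h => id_nonzero (D.label j).obj ?_⟩
  rw [← D.incl_proj_self j, h, comp_zero]

theorem IsUnitLabel.exists_label_eq {x : Irr M} (hx : IsUnitLabel x) : ∃ j, D.label j = x := by
  obtain ⟨f, hf⟩ := hx
  by_contra! hne
  apply hf
  rw [← Category.id_comp f, ← D.total, Preadditive.sum_comp]
  refine Finset.sum_eq_zero fun j _ => ?_
  rw [Category.assoc, hom_eq_zero_of_ne (hne j) (D.incl j ≫ f), comp_zero]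

variable {i : Irr M}

theorem isUnitLabel_of_iso (e : 𝟙_ M ≅ i.obj) : IsUnitLabel i := by
  refine ⟨e.hom, fun h => id_nonzero i.obj ?_⟩
  rw [← e.inv_hom_id, h, comp_zero]

theorem sameColumn_of_unit_iso (e : 𝟙_ M ≅ i.obj) (x y : Irr M) : SameColumn x y :=
  have tensor_ne_zero (z : Irr M) : ¬ IsZero (z.obj ⊗ i.obj) := fun hz =>
    Simple.not_isZero z.obj (hz.of_iso ((ρ_ z.obj).symm ≪≫ whiskerLeftIso z.obj e))
  ⟨i, isUnitLabel_of_iso e, tensor_ne_zero x, tensor_ne_zero y⟩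

theorem sameRow_of_unit_iso (e : 𝟙_ M ≅ i.obj) (x y : Irr M) : SameRow x y :=
  have tensor_ne_zero (z : Irr M) : ¬ IsZero (i.obj ⊗ z.obj) := fun hz =>
    Simple.not_isZero z.obj (hz.of_iso ((λ_ z.obj).symm ≪≫ whiskerRightIso e z.obj))
  ⟨i, isUnitLabel_of_iso e, tensor_ne_zero x, tensor_ne_zero y⟩

variable {x : M}

theorem isZero_of_rightAct_eq_zero (h : rightAct (D.idem k) x = 0) :
    IsZero (x ⊗ (D.label k).obj) := by
  rw [IsZero.iff_id_eq_zero]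
  calc 𝟙 (x ⊗ (D.label k).obj)
      = x ◁ D.incl k ≫ ((ρ_ x).hom ≫ rightAct (D.idem k) x ≫ (ρ_ x).inv) ≫ x ◁ D.proj k := by
        simp [rightAct, SimpleDecomp.idem, ← MonoidalCategory.whiskerLeft_comp,
          D.incl_proj_self]
    _ = 0 := by simp [h]

theorem isZero_of_leftAct_eq_zero (h : leftAct (D.idem k) x = 0) :
    IsZero ((D.label k).obj ⊗ x) := by
  rw [IsZero.iff_id_eq_zero]
  calc 𝟙 ((D.label k).obj ⊗ x)
      = D.incl k ▷ x ≫ ((λ_ x).hom ≫ leftAct (D.idem k) x ≫ (λ_ x).inv) ≫ D.proj k ▷ x := by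
        simp [leftAct, SimpleDecomp.idem, ← comp_whiskerRight, D.incl_proj_self]
    _ = 0 := by simp [h]

end UnitSummand

section Grading

variable {x : Irr C}

theorem eq_zero_or_eq_id_of_comp_self {f : x.obj ⟶ x.obj} (hf : f ≫ f = f) : f = 0 ∨ f = 𝟙 _ := by
  obtain ⟨r, rfl⟩ := exists_eq_smul_id f
  have : (r * (r - 1)) • 𝟙 x.obj = 0 := by
    rw [mul_sub, mul_one, sub_smul, sub_eq_zero]
    simpa [smul_smul] using hf
  have : r = 0 ∨ r = 1 := by
    simpa [id_nonzero, sub_eq_zero] using this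
  rcases this with rfl | rfl <;> simp

variable (D : SimpleDecomp (𝟙_ C)) {j k : Fin D.n}

theorem rightAct_eq_id (h : ¬ IsZero (x.obj ⊗ (D.label k).obj)) :
    rightAct (D.idem k) x.obj = 𝟙 _ :=
  (eq_zero_or_eq_id_of_comp_self (by rw [← rightAct_comp, D.idem_comp_self])).resolve_left
    (mt (isZero_of_rightAct_eq_zero D) h)

theorem leftAct_eq_id (h : ¬ IsZero ((D.label k).obj ⊗ x.obj)) : leftAct (D.idem k) x.obj = 𝟙 _ :=
  (eq_zero_or_eq_id_of_comp_self (by rw [← leftAct_comp, D.idem_comp_self])).resolve_left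
    (mt (isZero_of_leftAct_eq_zero D) h)

theorem rightAct_eq_zero_of_ne (h : ¬ IsZero (x.obj ⊗ (D.label k).obj)) (hjk : j ≠ k) :
    rightAct (D.idem j) x.obj = 0 := by
  rw [← Category.comp_id (rightAct _ _), ← rightAct_eq_id D h, ← rightAct_comp,
    D.idem_comp_of_ne hjk]
  simp [rightAct]

theorem leftAct_eq_zero_of_ne (h : ¬ IsZero ((D.label k).obj ⊗ x.obj)) (hjk : j ≠ k) :
    leftAct (D.idem j) x.obj = 0 := by
  rw [← Category.comp_id (leftAct _ _), ← leftAct_eq_id D h, ← leftAct_comp,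
    D.idem_comp_of_ne hjk]
  simp [leftAct]

end Grading

section Diagram

variable {a b c d e f g h : Irr C}

theorem diagram_eq_arc (μ : c.obj ⟶ d.obj ⊗ b.obj) (ν : d.obj ⟶ a.obj ⊗ e.obj)
    (ζ : a.obj ⊗ f.obj ⟶ g.obj) (γ : g.obj ⊗ b.obj ⟶ h.obj) :
    diagram μ ν ζ γ = arc a.obj b.obj (μ ≫ ν ▷ b.obj) (ζ ▷ b.obj ≫ γ) :=
  (arc_simple _ _).symm

theorem lDiagram_eq_lArc (ν : d.obj ⟶ a.obj ⊗ e.obj) (ζ : a.obj ⊗ f.obj ⟶ g.obj) :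
    lDiagram ν ζ = lArc a.obj ν ζ :=
  (lArc_simple _ _).symm

theorem rDiagram_eq_rArc (μ : c.obj ⟶ d.obj ⊗ b.obj) (γ : g.obj ⊗ b.obj ⟶ h.obj) :
    rDiagram μ γ = rArc b.obj μ γ :=
  (rArc_simple _ _).symm

theorem crossEquiv_cross_diagram (μ : c.obj ⟶ d.obj ⊗ b.obj) (ν : d.obj ⟶ a.obj ⊗ e.obj)
    (ζ : a.obj ⊗ f.obj ⟶ g.obj) (γ : g.obj ⊗ b.obj ⟶ h.obj) :
    crossEquiv (cross (rDiagram μ γ) (lDiagram ν ζ)) = diagram μ ν ζ γ := by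
  rw [rDiagram_eq_rArc, lDiagram_eq_lArc, crossEquiv_cross_arc, diagram_eq_arc, edge_self,
    edge_self, Category.id_comp, Category.comp_id]

theorem crossEquiv_cross_diagram_of_ne {d' g' : Irr C} (μ : c.obj ⟶ d.obj ⊗ b.obj)
    (ν : d'.obj ⟶ a.obj ⊗ e.obj) (ζ : a.obj ⊗ f.obj ⟶ g'.obj) (γ : g.obj ⊗ b.obj ⟶ h.obj)
    (hne : d ≠ d' ∨ g ≠ g') : crossEquiv (cross (rDiagram μ γ) (lDiagram ν ζ)) = 0 := by
  rw [rDiagram_eq_rArc, lDiagram_eq_lArc, cross_eq_zero hne, map_zero]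

theorem arc_eq_sum_diagram (p : c.obj ⟶ (a.obj ⊗ e.obj) ⊗ b.obj)
    (q : (a.obj ⊗ f.obj) ⊗ b.obj ⟶ h.obj) :
    arc a.obj b.obj p q = ∑ m, ∑ n,
      diagram (p ≫ (decomp (a.obj ⊗ e.obj)).proj m ▷ b.obj) ((decomp (a.obj ⊗ e.obj)).incl m)
        ((decomp (a.obj ⊗ f.obj)).proj n) ((decomp (a.obj ⊗ f.obj)).incl n ▷ b.obj ≫ q) := by
  rw [← glue_cut, cut_tmul]
  simp only [map_sum, glue_arc, edge_self, Category.id_comp, Category.comp_id, diagram_eq_arc]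

theorem arc_mem_leftPart (hb : IsUnitLabel b) (p : c.obj ⟶ (a.obj ⊗ e.obj) ⊗ b.obj)
    (q : (a.obj ⊗ f.obj) ⊗ b.obj ⟶ h.obj) : arc a.obj b.obj p q ∈ leftPart C := by
  rw [arc_eq_sum_diagram]
  exact sum_mem fun m _ => sum_mem fun n _ =>
    Submodule.subset_span ⟨_, _, _, _, _, _, _, _, _, _, _, _, hb, rfl⟩

theorem arc_mem_rightPart (ha : IsUnitLabel a) (p : c.obj ⟶ (a.obj ⊗ e.obj) ⊗ b.obj)
    (q : (a.obj ⊗ f.obj) ⊗ b.obj ⟶ h.obj) : arc a.obj b.obj p q ∈ rightPart C := by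
  rw [arc_eq_sum_diagram]
  exact sum_mem fun m _ => sum_mem fun n _ =>
    Submodule.subset_span ⟨_, _, _, _, _, _, _, _, _, _, _, _, ha, rfl⟩

end Diagram

section BoundaryInBulk

variable {A B : C} {a b c d e f g h : Irr C}

theorem arc_eq_sum_right (p : c.obj ⟶ (A ⊗ e.obj) ⊗ B) (q : (A ⊗ f.obj) ⊗ B ⟶ h.obj) :
    arc A B p q = ∑ j, arc A ((decomp B).label j).obj (p ≫ (A ⊗ e.obj) ◁ (decomp B).proj j)
      ((A ⊗ f.obj) ◁ (decomp B).incl j ≫ q) := by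
  simp only [arc_dinatural_right, ← arc_sum_right, ← MonoidalCategory.whiskerLeft_comp_assoc,
    ← Preadditive.sum_comp, ← whiskerLeft_sum, SimpleDecomp.total]
  rw [MonoidalCategory.whiskerLeft_id, Category.id_comp]

theorem arc_eq_sum_left (p : c.obj ⟶ (A ⊗ e.obj) ⊗ B) (q : (A ⊗ f.obj) ⊗ B ⟶ h.obj) :
    arc A B p q = ∑ j, arc ((decomp A).label j).obj B (p ≫ ((decomp A).proj j ▷ e.obj) ▷ B)
      (((decomp A).incl j ▷ f.obj) ▷ B ≫ q) := by
  simp only [arc_dinatural_left, ← arc_sum_right, ← comp_whiskerRight_assoc, ← comp_whiskerRight,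
    ← Preadditive.sum_comp, ← sum_whiskerRight, SimpleDecomp.total]
  rw [id_whiskerRight, id_whiskerRight, Category.id_comp]

theorem lToTube_lArc_eq_sum (ν : d.obj ⟶ A ⊗ e.obj) (ζ : A ⊗ f.obj ⟶ g.obj) :
    lToTube (lArc A ν ζ) = ∑ j, arc A ((decomp (𝟙_ C)).label j).obj
      ((ρ_ _).inv ≫ d.obj ◁ (decomp (𝟙_ C)).proj j ≫ ν ▷ _)
      (ζ ▷ _ ≫ g.obj ◁ (decomp (𝟙_ C)).incl j ≫ (ρ_ _).hom) := by
  rw [lToTube_lArc, arc_eq_sum_right]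
  refine Finset.sum_congr rfl fun j _ => arc_congr (𝟙 _) (𝟙 _) ?_ ?_
  · simp [whisker_exchange]
  · simp [← whisker_exchange_assoc]

theorem rToTube_rArc_eq_sum (μ : c.obj ⟶ d.obj ⊗ B) (γ : g.obj ⊗ B ⟶ h.obj) :
    rToTube (rArc B μ γ) = ∑ j, arc ((decomp (𝟙_ C)).label j).obj B
      ((λ_ _).inv ≫ (decomp (𝟙_ C)).proj j ▷ c.obj ≫ _ ◁ μ ≫ (α_ _ _ _).inv)
      ((α_ _ _ _).hom ≫ _ ◁ γ ≫ (decomp (𝟙_ C)).incl j ▷ h.obj ≫ (λ_ _).hom) := by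
  rw [rToTube_rArc, arc_eq_sum_left]
  refine Finset.sum_congr rfl fun j _ => arc_congr (𝟙 _) (𝟙 _) ?_ ?_
  · simp [← whisker_exchange_assoc]
  · simp [whisker_exchange_assoc]

/-- Contraction of the right arc with the tensor unit. It is a section of `lToTube` over the
diagrams whose right arc is trivial, and a retraction of `lToTube` on the diagrams whose outer edges
lie in the same column. -/
def tubeToL : Tube C →ₗ[ℂ] LTube C :=
  DirectSum.toModule ℂ (TubeLabel C) _ fun t =>
    ∑ k, lOf ⟨t.a, t.c, t.e, t.f, t.h⟩ ∘ₗ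
      TensorProduct.map
        (Linear.rightComp ℂ t.c.obj
          (_ ◁ (edge t.b ((decomp (𝟙_ C)).label k) ≫ (decomp (𝟙_ C)).incl k) ≫ (ρ_ _).hom))
        (Linear.leftComp ℂ t.h.obj
          ((ρ_ _).inv ≫ _ ◁ ((decomp (𝟙_ C)).proj k ≫ edge ((decomp (𝟙_ C)).label k) t.b)))

/-- Contraction of the left arc with the tensor unit. It is a section of `rToTube` over the
diagrams whose left arc is trivial, and a retraction of `rToTube` on the diagrams whose outer edges
lie in the same row. -/
def tubeToR : Tube C →ₗ[ℂ] RTube C :=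
  DirectSum.toModule ℂ (TubeLabel C) _ fun t =>
    ∑ k, rOf ⟨t.b, t.c, t.e, t.f, t.h⟩ ∘ₗ
      TensorProduct.map
        (Linear.rightComp ℂ t.c.obj
          (((edge t.a ((decomp (𝟙_ C)).label k) ≫ (decomp (𝟙_ C)).incl k) ▷ _ ≫ (λ_ _).hom) ▷ _))
        (Linear.leftComp ℂ t.h.obj
          (((λ_ _).inv ≫ ((decomp (𝟙_ C)).proj k ≫ edge ((decomp (𝟙_ C)).label k) t.a) ▷ _) ▷ _))

theorem tubeToL_arc_label (j : Fin (decomp (𝟙_ C)).n)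
    (p : c.obj ⟶ (a.obj ⊗ e.obj) ⊗ ((decomp (𝟙_ C)).label j).obj)
    (q : (a.obj ⊗ f.obj) ⊗ ((decomp (𝟙_ C)).label j).obj ⟶ h.obj) :
    tubeToL (arc a.obj ((decomp (𝟙_ C)).label j).obj p q) =
      lArc a.obj (p ≫ _ ◁ (decomp (𝟙_ C)).incl j ≫ (ρ_ _).hom)
        (((ρ_ _).inv ≫ _ ◁ (decomp (𝟙_ C)).proj j) ≫ q) := by
  rw [arc_simple, lArc_simple, tubeToL, tubeOf, DirectSum.toModule_lof, LinearMap.sum_apply,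
    Fintype.sum_eq_single j fun k hk => by simp [SimpleDecomp.edge_label_of_ne _ hk]]
  simp

theorem tubeToR_arc_label (j : Fin (decomp (𝟙_ C)).n)
    (p : c.obj ⟶ (((decomp (𝟙_ C)).label j).obj ⊗ e.obj) ⊗ b.obj)
    (q : (((decomp (𝟙_ C)).label j).obj ⊗ f.obj) ⊗ b.obj ⟶ h.obj) :
    tubeToR (arc ((decomp (𝟙_ C)).label j).obj b.obj p q) =
      rArc b.obj (p ≫ ((decomp (𝟙_ C)).incl j ▷ _ ≫ (λ_ _).hom) ▷ _)
        (((λ_ _).inv ≫ (decomp (𝟙_ C)).proj j ▷ _) ▷ _ ≫ q) := by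
  rw [arc_simple, rArc_simple, tubeToR, tubeOf, DirectSum.toModule_lof, LinearMap.sum_apply,
    Fintype.sum_eq_single j fun k hk => by simp [SimpleDecomp.edge_label_of_ne _ hk]]
  simp

theorem lToTube_tubeToL_arc (hb : IsUnitLabel b) (p : c.obj ⟶ (a.obj ⊗ e.obj) ⊗ b.obj)
    (q : (a.obj ⊗ f.obj) ⊗ b.obj ⟶ h.obj) :
    lToTube (tubeToL (arc a.obj b.obj p q)) = arc a.obj b.obj p q := by
  obtain ⟨j, rfl⟩ := hb.exists_label_eq (decomp (𝟙_ C))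
  rw [tubeToL_arc_label, lToTube_lArc]
  refine (arc_congr (𝟙 _) ((decomp (𝟙_ C)).incl j) (by simp) ?_).symm
  simp only [id_whiskerRight, id_tensorHom, Category.assoc, Iso.hom_inv_id_assoc,
    ← MonoidalCategory.whiskerLeft_comp_assoc, (decomp (𝟙_ C)).incl_proj_self]
  simp

theorem rToTube_tubeToR_arc (ha : IsUnitLabel a) (p : c.obj ⟶ (a.obj ⊗ e.obj) ⊗ b.obj)
    (q : (a.obj ⊗ f.obj) ⊗ b.obj ⟶ h.obj) :
    rToTube (tubeToR (arc a.obj b.obj p q)) = arc a.obj b.obj p q := by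
  obtain ⟨j, rfl⟩ := ha.exists_label_eq (decomp (𝟙_ C))
  rw [tubeToR_arc_label, rToTube_rArc]
  refine (arc_congr ((decomp (𝟙_ C)).incl j) (𝟙 _) (by simp) ?_).symm
  simp only [tensorHom_id, ← comp_whiskerRight_assoc, Iso.hom_inv_id_assoc,
    ← comp_whiskerRight, (decomp (𝟙_ C)).incl_proj_self]
  simp

theorem tubeToL_lToTube_lArc (ν : d.obj ⟶ a.obj ⊗ e.obj) (ζ : a.obj ⊗ f.obj ⟶ g.obj) :
    tubeToL (lToTube (lArc a.obj ν ζ)) =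
      ∑ j, lArc a.obj (rightAct ((decomp (𝟙_ C)).idem j) d.obj ≫ ν)
        (ζ ≫ rightAct ((decomp (𝟙_ C)).idem j) g.obj) := by
  simp only [lToTube_lArc_eq_sum, map_sum, tubeToL_arc_label, SimpleDecomp.idem,
    rightUnitor_inv_whisker_comp_rightUnitor_hom, rightUnitor_inv_comp_whisker_rightUnitor_hom]

theorem tubeToR_rToTube_rArc (μ : c.obj ⟶ d.obj ⊗ b.obj) (γ : g.obj ⊗ b.obj ⟶ h.obj) :
    tubeToR (rToTube (rArc b.obj μ γ)) =
      ∑ j, rArc b.obj (leftAct ((decomp (𝟙_ C)).idem j) c.obj ≫ μ)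
        (γ ≫ leftAct ((decomp (𝟙_ C)).idem j) h.obj) := by
  simp only [rToTube_rArc_eq_sum, map_sum, tubeToR_arc_label, SimpleDecomp.idem,
    leftUnitor_inv_whisker_comp_leftUnitor_hom, leftUnitor_inv_comp_whisker_leftUnitor_hom]

theorem tubeToL_lToTube_of_sameColumn (hdg : SameColumn d g) (ν : d.obj ⟶ a.obj ⊗ e.obj)
    (ζ : a.obj ⊗ f.obj ⟶ g.obj) : tubeToL (lToTube (lArc a.obj ν ζ)) = lArc a.obj ν ζ := by
  obtain ⟨b, hb, hd, hg⟩ := hdg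
  obtain ⟨k, rfl⟩ := hb.exists_label_eq (decomp (𝟙_ C))
  rw [tubeToL_lToTube_lArc, Fintype.sum_eq_single k fun j hj => ?_]
  · rw [rightAct_eq_id _ hd, rightAct_eq_id _ hg, Category.id_comp, Category.comp_id]
  · simp [rightAct_eq_zero_of_ne _ hd hj]

theorem tubeToR_rToTube_of_sameRow (hch : SameRow c h) (μ : c.obj ⟶ d.obj ⊗ b.obj)
    (γ : g.obj ⊗ b.obj ⟶ h.obj) : tubeToR (rToTube (rArc b.obj μ γ)) = rArc b.obj μ γ := by
  obtain ⟨a, ha, hc, hh⟩ := hch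
  obtain ⟨k, rfl⟩ := ha.exists_label_eq (decomp (𝟙_ C))
  rw [tubeToR_rToTube_rArc, Fintype.sum_eq_single k fun j hj => ?_]
  · rw [leftAct_eq_id _ hc, leftAct_eq_id _ hh, Category.id_comp, Category.comp_id]
  · simp [leftAct_eq_zero_of_ne _ hc hj]

theorem range_lToTube : LinearMap.range (lToTube (C := C)) = leftPart C := by
  apply le_antisymm
  · rw [← (leftPart C).ker_mkQ, LinearMap.range_le_ker_iff]
    refine LTube.hom_ext fun a d e f g p q => (Submodule.Quotient.mk_eq_zero _).2 ?_
    rw [lToTube_lArc_eq_sum]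
    exact sum_mem fun j _ => arc_mem_leftPart (isUnitLabel_label _ j) _ _
  · refine Submodule.span_le.2 ?_
    rintro _ ⟨a, b, c, d, e, f, g, h, μ, ν, ζ, γ, hb, rfl⟩
    rw [diagram_eq_arc]
    exact ⟨_, lToTube_tubeToL_arc hb _ _⟩

theorem range_rToTube : LinearMap.range (rToTube (C := C)) = rightPart C := by
  apply le_antisymm
  · rw [← (rightPart C).ker_mkQ, LinearMap.range_le_ker_iff]
    refine RTube.hom_ext fun b c e f h p q => (Submodule.Quotient.mk_eq_zero _).2 ?_
    rw [rToTube_rArc_eq_sum]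
    exact sum_mem fun j _ => arc_mem_rightPart (isUnitLabel_label _ j) _ _
  · refine Submodule.span_le.2 ?_
    rintro _ ⟨a, b, c, d, e, f, g, h, μ, ν, ζ, γ, ha, rfl⟩
    rw [diagram_eq_arc]
    exact ⟨_, rToTube_tubeToR_arc ha _ _⟩

theorem lToTube_lArc_eq_zero (hdg : ¬ SameColumn d g) (ν : d.obj ⟶ A ⊗ e.obj)
    (ζ : A ⊗ f.obj ⟶ g.obj) : lToTube (lArc A ν ζ) = 0 := by
  rw [lToTube_lArc_eq_sum]
  refine Finset.sum_eq_zero fun j _ => ?_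
  by_cases hd : IsZero (d.obj ⊗ ((decomp (𝟙_ C)).label j).obj)
  · simp [hd.eq_zero_of_tgt (d.obj ◁ _)]
  · have hg : IsZero (g.obj ⊗ ((decomp (𝟙_ C)).label j).obj) := by
      by_contra hg
      exact hdg ⟨_, isUnitLabel_label _ j, hd, hg⟩
    simp [hg.eq_zero_of_src (g.obj ◁ _)]

theorem rToTube_rArc_eq_zero (hch : ¬ SameRow c h) (μ : c.obj ⟶ d.obj ⊗ B)
    (γ : g.obj ⊗ B ⟶ h.obj) : rToTube (rArc B μ γ) = 0 := by
  rw [rToTube_rArc_eq_sum]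
  refine Finset.sum_eq_zero fun j _ => ?_
  by_cases hc : IsZero (((decomp (𝟙_ C)).label j).obj ⊗ c.obj)
  · simp [hc.eq_zero_of_tgt (_ ▷ c.obj)]
  · have hh : IsZero (((decomp (𝟙_ C)).label j).obj ⊗ h.obj) := by
      by_contra hh
      exact hch ⟨_, isUnitLabel_label _ j, hc, hh⟩
    simp [hh.eq_zero_of_src (_ ▷ h.obj)]

theorem lMismatch_mkQ_comp_tubeToL_comp_lToTube :
    ((lMismatch C).mkQ ∘ₗ tubeToL) ∘ₗ lToTube = (lMismatch C).mkQ := by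
  refine LTube.hom_ext fun a d e f g ν ζ => ?_
  simp only [LinearMap.comp_apply]
  by_cases hdg : SameColumn d g
  · rw [tubeToL_lToTube_of_sameColumn hdg]
  · rw [lToTube_lArc_eq_zero hdg, map_zero, map_zero]
    have mismatch : lArc a.obj ν ζ ∈ lMismatch C :=
      Submodule.subset_span ⟨a, d, e, f, g, ν, ζ, hdg, (lDiagram_eq_lArc ν ζ).symm⟩
    exact ((Submodule.Quotient.mk_eq_zero _).2 mismatch).symm

theorem rMismatch_mkQ_comp_tubeToR_comp_rToTube :
    ((rMismatch C).mkQ ∘ₗ tubeToR) ∘ₗ rToTube = (rMismatch C).mkQ := by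
  refine RTube.hom_ext fun b c d g h μ γ => ?_
  simp only [LinearMap.comp_apply]
  by_cases hch : SameRow c h
  · rw [tubeToR_rToTube_of_sameRow hch]
  · rw [rToTube_rArc_eq_zero hch, map_zero, map_zero]
    have mismatch : rArc b.obj μ γ ∈ rMismatch C :=
      Submodule.subset_span ⟨b, c, d, g, h, μ, γ, hch, (rDiagram_eq_rArc μ γ).symm⟩
    exact ((Submodule.Quotient.mk_eq_zero _).2 mismatch).symm

theorem ker_lToTube : LinearMap.ker (lToTube (C := C)) = lMismatch C := by
  apply le_antisymm
  · rw [← (lMismatch C).ker_mkQ, ← lMismatch_mkQ_comp_tubeToL_comp_lToTube]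
    exact LinearMap.ker_le_ker_comp _ _
  · refine Submodule.span_le.2 ?_
    rintro _ ⟨a, d, e, f, g, ν, ζ, hdg, rfl⟩
    rw [lDiagram_eq_lArc]
    exact lToTube_lArc_eq_zero hdg ν ζ

theorem ker_rToTube : LinearMap.ker (rToTube (C := C)) = rMismatch C := by
  apply le_antisymm
  · rw [← (rMismatch C).ker_mkQ, ← rMismatch_mkQ_comp_tubeToR_comp_rToTube]
    exact LinearMap.ker_le_ker_comp _ _
  · refine Submodule.span_le.2 ?_
    rintro _ ⟨b, c, d, g, h, μ, γ, hch, rfl⟩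
    rw [rDiagram_eq_rArc]
    exact rToTube_rArc_eq_zero hch μ γ

theorem lToTube_injective [Simple (𝟙_ C)] : Function.Injective (lToTube (C := C)) := by
  obtain ⟨i, ⟨unitIso⟩⟩ := exists_irr_iso (𝟙_ C) inferInstance
  rw [← LinearMap.ker_eq_bot, ker_lToTube, lMismatch, Submodule.span_eq_bot]
  rintro _ ⟨a, d, e, f, g, ν, ζ, hdg, rfl⟩
  exact absurd (sameColumn_of_unit_iso unitIso d g) hdg

theorem rToTube_injective [Simple (𝟙_ C)] : Function.Injective (rToTube (C := C)) := by
  obtain ⟨i, ⟨unitIso⟩⟩ := exists_irr_iso (𝟙_ C) inferInstance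
  rw [← LinearMap.ker_eq_bot, ker_rToTube, rMismatch, Submodule.span_eq_bot]
  rintro _ ⟨b, c, d, g, h, μ, γ, hch, rfl⟩
  exact absurd (sameRow_of_unit_iso unitIso c h) hch

end BoundaryInBulk

end TubeAlgebra

end

theorem mainTheorem5 (C : Type u) [Category.{v} C] [Abelian C] [Linear ℂ C]
    [MonoidalCategory C] [MonoidalPreadditive C] [MonoidalLinear ℂ C] [RigidCategory C]
    [TubeAlgebra.MultifusionCategory C] :
    -- the four spaces with their multiplications and units are algebras
    (TubeAlgebra.IsAlgebra (TubeAlgebra.tubeMul (C := C)) TubeAlgebra.tubeOne ∧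
      TubeAlgebra.IsAlgebra (TubeAlgebra.lMul (C := C)) TubeAlgebra.lOne ∧
      TubeAlgebra.IsAlgebra (TubeAlgebra.rMul (C := C)) TubeAlgebra.rOne ∧
      TubeAlgebra.IsAlgebra (TubeAlgebra.crossMul (C := C)) TubeAlgebra.crossOne) ∧
    -- the left boundary tube algebra inside the bulk tube algebra
    ((∀ x y : TubeAlgebra.LTube C, TubeAlgebra.lToTube (TubeAlgebra.lMul x y) =
        TubeAlgebra.tubeMul (TubeAlgebra.lToTube x) (TubeAlgebra.lToTube y)) ∧
      TubeAlgebra.lToTube (C := C) TubeAlgebra.lOne = TubeAlgebra.tubeOne ∧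
      (∀ x : TubeAlgebra.LTube C, TubeAlgebra.tubeComul (TubeAlgebra.lToTube x) =
        TensorProduct.map TubeAlgebra.lToTube TubeAlgebra.lToTube (TubeAlgebra.lComul x)) ∧
      (∀ x : TubeAlgebra.LTube C,
        TubeAlgebra.tubeCounit (TubeAlgebra.lToTube x) = TubeAlgebra.lCounit x) ∧
      LinearMap.range (TubeAlgebra.lToTube (C := C)) = TubeAlgebra.leftPart C ∧
      LinearMap.ker (TubeAlgebra.lToTube (C := C)) = TubeAlgebra.lMismatch C ∧
      (Simple (𝟙_ C) → Function.Injective (TubeAlgebra.lToTube (C := C)))) ∧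
    -- the right boundary tube algebra inside the bulk tube algebra
    ((∀ x y : TubeAlgebra.RTube C, TubeAlgebra.rToTube (TubeAlgebra.rMul x y) =
        TubeAlgebra.tubeMul (TubeAlgebra.rToTube x) (TubeAlgebra.rToTube y)) ∧
      TubeAlgebra.rToTube (C := C) TubeAlgebra.rOne = TubeAlgebra.tubeOne ∧
      (∀ x : TubeAlgebra.RTube C, TubeAlgebra.tubeComul (TubeAlgebra.rToTube x) =
        TensorProduct.map TubeAlgebra.rToTube TubeAlgebra.rToTube (TubeAlgebra.rComul x)) ∧
      (∀ x : TubeAlgebra.RTube C,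
        TubeAlgebra.tubeCounit (TubeAlgebra.rToTube x) = TubeAlgebra.rCounit x) ∧
      LinearMap.range (TubeAlgebra.rToTube (C := C)) = TubeAlgebra.rightPart C ∧
      LinearMap.ker (TubeAlgebra.rToTube (C := C)) = TubeAlgebra.rMismatch C ∧
      (Simple (𝟙_ C) → Function.Injective (TubeAlgebra.rToTube (C := C)))) ∧
    -- gluing is an isomorphism from the crossed product to the bulk tube algebra
    ∃ Φ : TubeAlgebra.CrossedProduct C ≃ₗ[ℂ] TubeAlgebra.Tube C,
      (∀ (a b c d e f g h : TubeAlgebra.Irr C) (μ : c.obj ⟶ d.obj ⊗ b.obj)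
        (ν : d.obj ⟶ a.obj ⊗ e.obj) (ζ : a.obj ⊗ f.obj ⟶ g.obj) (γ : g.obj ⊗ b.obj ⟶ h.obj),
        Φ (TubeAlgebra.cross (TubeAlgebra.rDiagram μ γ) (TubeAlgebra.lDiagram ν ζ)) =
          TubeAlgebra.diagram μ ν ζ γ) ∧
      (∀ (a b c d d' e f g g' h : TubeAlgebra.Irr C) (μ : c.obj ⟶ d.obj ⊗ b.obj)
        (ν : d'.obj ⟶ a.obj ⊗ e.obj) (ζ : a.obj ⊗ f.obj ⟶ g'.obj) (γ : g.obj ⊗ b.obj ⟶ h.obj),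
        (d ≠ d' ∨ g ≠ g') →
          Φ (TubeAlgebra.cross (TubeAlgebra.rDiagram μ γ) (TubeAlgebra.lDiagram ν ζ)) = 0) ∧
      (∀ (r : TubeAlgebra.RTube C) (l : TubeAlgebra.LTube C), Φ (TubeAlgebra.cross r l) =
        TubeAlgebra.tubeMul (TubeAlgebra.rToTube r) (TubeAlgebra.lToTube l)) ∧
      (∀ x y : TubeAlgebra.CrossedProduct C,
        Φ (TubeAlgebra.crossMul x y) = TubeAlgebra.tubeMul (Φ x) (Φ y)) ∧
      Φ TubeAlgebra.crossOne = TubeAlgebra.tubeOne ∧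
      (∀ x : TubeAlgebra.CrossedProduct C, TubeAlgebra.tubeComul (Φ x) =
        TensorProduct.map Φ.toLinearMap Φ.toLinearMap (TubeAlgebra.crossComul x)) :=
  ⟨⟨TubeAlgebra.isAlgebra_tube, TubeAlgebra.isAlgebra_lTube, TubeAlgebra.isAlgebra_rTube,
      TubeAlgebra.isAlgebra_crossedProduct⟩,
    ⟨TubeAlgebra.lToTube_lMul, TubeAlgebra.lToTube_lOne, TubeAlgebra.tubeComul_lToTube,
      TubeAlgebra.tubeCounit_lToTube, TubeAlgebra.range_lToTube, TubeAlgebra.ker_lToTube,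
      fun _ => TubeAlgebra.lToTube_injective⟩,
    ⟨TubeAlgebra.rToTube_rMul, TubeAlgebra.rToTube_rOne, TubeAlgebra.tubeComul_rToTube,
      TubeAlgebra.tubeCounit_rToTube, TubeAlgebra.range_rToTube, TubeAlgebra.ker_rToTube,
      fun _ => TubeAlgebra.rToTube_injective⟩,
    TubeAlgebra.crossEquiv, fun _ _ _ _ _ _ _ _ => TubeAlgebra.crossEquiv_cross_diagram,
    fun _ _ _ _ _ _ _ _ _ _ => TubeAlgebra.crossEquiv_cross_diagram_of_ne,
    TubeAlgebra.crossEquiv_cross, TubeAlgebra.crossEquiv_crossMul, TubeAlgebra.crossEquiv_crossOne,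
    TubeAlgebra.tubeComul_crossEquiv⟩
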